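/- Let $R$ be a commutative ring. An $R$-homology $n$-manifold ($n\ge 0$) is a locally finite simplicial complex $L$ such that the link of every $i$-simplex of $L$ has the same $R$-homology as an $(n-i-1)$-sphere, where a sphere of negative dimension is empty. It is orientable if its $n$-simplices can be oriented consistently across every $(n-1)$-simplex; such a choice is an orientation of $L$ (for $n=0$ it is a choice of signs of the vertices). A connected $L$ has two orientations or none (for $R\neq 0$). For a locally finite simplicial complex $L$, $H_c^*(L;R)$ denotes the cohomology of the complex of those $R$-valued simplicial cochains on $L$ which vanish on all but finitely many simplices, and $H_*(L;R)$ denotes the simplicial homology; both are zero in negative degrees. Let $L$ be a connected $R$-homology $n$-manifold, and let $\Gamma$ be a group acting freely and simplicially on $L$. Suppose that $L$ is orientable or that $R$ has characteristic two. If $L$ is orientable, let $R^\circ$ be the right $R\Gamma$-module with underlying $R$-module $R$ on which $\gamma\in\Gamma$ acts as multiplication by $-1$ if $\gamma$ exchanges the two orientations of $L$, and as the identity if $\gamma$ preserves them. If $R$ has characteristic two, let $R^\circ$ be $R$ with the trivial right $\Gamma$-action (if $L$ is also orientable, the two definitions agree). Then for each integer $i$ there is an isomorphism of right $R\Gamma$-modules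 $$H_c^i(L;R)\otimes_R R^\circ\;\cong\; H_{n-i}(L;R),$$ where $\Gamma$ acts diagonally on the tensor product, $H_c^i(L;R)$ carries the right action induced by the left action of $\Gamma$ on $L$, and $\gamma$ acts on the right on $H_{n-i}(L;R)$ as the map induced by $\gamma^{-1}$. -/

import Mathlib

open scoped TensorProduct

noncomputable section

namespace HomologyManifold

universe u v w

variable {V : Type u} (K : PreAbstractSimplicialComplex V) (R : Type v) [CommRing R]

/-! ### Ordered simplices, links, local finiteness, connectedness -/

open Classical in
/-- `x` lists, without repetition, the vertices of a simplex of `K` with `k` vertices, that is, of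
dimension `k - 1`. As simplices are non-empty, there is no such `x` for `k = 0`. -/
def IsOrderedSimplex {k : ℕ} (x : Fin k → V) : Prop :=
  Function.Injective x ∧ Finset.univ.image x ∈ K

open Classical in
/-- The link of `s` in `K`: the simplices of `K` having no vertex in common with `s` and whose
union with `s` is a simplex of `K`. -/
def link (s : Finset V) : PreAbstractSimplicialComplex V where
  faces := {t | t ∈ K ∧ Disjoint t s ∧ t ∪ s ∈ K}
  isRelLowerSet_faces := by
    rintro t ⟨htK, hts, hu⟩
    refine ⟨(K.isRelLowerSet_faces htK).1, fun r hrt hr => ⟨?_, ?_, ?_⟩⟩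
    · exact (K.isRelLowerSet_faces htK).2 hrt hr
    · exact Finset.disjoint_of_subset_left hrt hts
    · exact (K.isRelLowerSet_faces hu).2 (Finset.union_subset_union_left hrt)
        (hr.mono Finset.subset_union_left)

/-- Every vertex lies in only finitely many simplices. -/
def LocallyFinite : Prop := ∀ a : V, {s : Finset V | s ∈ K ∧ a ∈ s}.Finite

open Classical in
/-- The graph whose vertices and edges are the `0`- and the `1`-simplices of `L`. -/
def oneSkeleton (L : AbstractSimplicialComplex V) : SimpleGraph V where
  Adj a b := a ≠ b ∧ ({a, b} : Finset V) ∈ L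
  symm := ⟨fun a b h => ⟨h.1.symm, by rw [Finset.pair_comm]; exact h.2⟩⟩
  loopless := ⟨fun _ h => h.1 rfl⟩

/-! ### Oriented simplicial chains and cochains -/

/-- The simplicial `R`-valued cochains on the simplices of `K` with `k` vertices (degree `k - 1`):
functions of oriented simplices changing sign with the orientation, that is, alternating functions
of ordered simplices, here extended by zero to all `k`-tuples of vertices. -/
def cochains (k : ℕ) : Submodule R ((Fin k → V) → R) where
  carrier := {f | (∀ x, ¬ IsOrderedSimplex K x → f x = 0) ∧
    ∀ x (π : Equiv.Perm (Fin k)), f (x ∘ π) = (Equiv.Perm.sign π : ℤ) • f x}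
  zero_mem' := by simp
  add_mem' := by
    rintro f g ⟨hf, hf'⟩ ⟨hg, hg'⟩
    refine ⟨fun x hx => by simp [hf x hx, hg x hx], fun x π => ?_⟩
    simp only [Pi.add_apply, hf' x π, hg' x π, smul_add]
  smul_mem' := by
    rintro r f ⟨hf, hf'⟩
    refine ⟨fun x hx => by simp [hf x hx], fun x π => ?_⟩
    simp only [Pi.smul_apply, hf' x π, smul_comm r]

/-- The cochains vanishing on all but finitely many simplices. -/
def compactCochains (k : ℕ) : Submodule R ((Fin k → V) → R) where
  carrier := {f | f ∈ cochains K R k ∧ f.support.Finite}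
  zero_mem' := ⟨zero_mem _, by simp⟩
  add_mem' := fun hf hg =>
    ⟨add_mem hf.1 hg.1, (hf.2.union hg.2).subset (Function.support_add _ _)⟩
  smul_mem' := fun r _ hf =>
    ⟨Submodule.smul_mem _ r hf.1, hf.2.subset (Function.support_const_smul_subset r _)⟩

open Classical in
/-- The simplicial coboundary, `(δ f)(v₀, …, vₖ) = ∑ⱼ (-1)ʲ f(v₀, …, v̂ⱼ, …, vₖ)` on ordered
simplices. -/
def coboundary (k : ℕ) : ((Fin k → V) → R) →ₗ[R] ((Fin (k + 1) → V) → R) where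
  toFun f x := if IsOrderedSimplex K x then
    ∑ j : Fin (k + 1), (-1 : R) ^ (j : ℕ) * f (x ∘ j.succAbove) else 0
  map_add' f g := by
    ext x
    by_cases h : IsOrderedSimplex K x <;> simp [h, mul_add, Finset.sum_add_distrib]
  map_smul' r f := by
    ext x
    by_cases h : IsOrderedSimplex K x <;> simp [h, Finset.mul_sum, mul_left_comm]

/-- The simplicial chains on the simplices of `K` with `k` vertices (degree `k - 1`): finitely
supported functions of oriented simplices changing sign with the orientation. The oriented simplex
`[v₁, …, vₖ]` is the function with the value `sign π` at `(v_π(1), …, v_π(k))` for each permutation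
`π`, and the value zero elsewhere. -/
def chains (k : ℕ) : Submodule R ((Fin k → V) →₀ R) :=
  (cochains K R k).comap Finsupp.lcoeFun

open Classical in
/-- The simplicial boundary: `(∂ c)(w) = ∑ᵥ c(v, w)` on ordered simplices `w`. On chains this is
the usual `∂ [v₀, …, vₖ] = ∑ⱼ (-1)ʲ [v₀, …, v̂ⱼ, …, vₖ]` in positive degrees, and zero in
degree zero. -/
def boundary (k : ℕ) : ((Fin (k + 1) → V) →₀ R) →ₗ[R] ((Fin k → V) →₀ R) :=
  Finsupp.linearCombination R fun x =>
    if IsOrderedSimplex K (Fin.tail x) then Finsupp.single (Fin.tail x) 1 else 0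

/-! ### Homology and cohomology with compact supports -/

/-- The cycles among the chains on simplices with `k` vertices. -/
def cycles : (k : ℕ) → Submodule R ((Fin k → V) →₀ R)
  | 0 => chains K R 0
  | k + 1 => chains K R (k + 1) ⊓ LinearMap.ker (boundary K R k)

/-- The boundaries among the chains on simplices with `k` vertices. -/
def boundaries (k : ℕ) : Submodule R ((Fin k → V) →₀ R) :=
  (chains K R (k + 1)).map (boundary K R k)

/-- The compactly supported cocycles on simplices with `k` vertices. -/
def cocycles (k : ℕ) : Submodule R ((Fin k → V) → R) :=
  compactCochains K R k ⊓ LinearMap.ker (coboundary K R k)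

/-- The coboundaries, on simplices with `k` vertices, of compactly supported cochains. -/
def coboundaries : (k : ℕ) → Submodule R ((Fin k → V) → R)
  | 0 => ⊥
  | k + 1 => (compactCochains K R k).map (coboundary K R k)

/-- The quotient of a submodule `Z` by the elements of `B` (which lie in `Z` in all cases below). -/
abbrev Subquotient {R : Type v} [CommRing R] {M : Type w} [AddCommGroup M] [Module R M]
    (Z B : Submodule R M) : Type w :=
  Z ⧸ B.comap Z.subtype

/-- The simplicial homology `H_i(K; R)` in degree `i`. The simplices of dimension `i` are those with
`i + 1` vertices; in negative degrees there are no chains, and the homology is zero. -/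
abbrev Homology (i : ℤ) : Type (max u v) :=
  Subquotient (cycles K R (i + 1).toNat) (boundaries K R (i + 1).toNat)

/-- The cohomology with compact supports `H_c^i(K; R)` of a locally finite complex, in
degree `i`. -/
abbrev CompactCohomology (i : ℤ) : Type (max u v) :=
  Subquotient (cocycles K R (i + 1).toNat) (coboundaries K R (i + 1).toNat)

/-! ### Homology manifolds and orientations -/

/-- The rank of the homology in degree `j` of a sphere of dimension `m`; a sphere of negative
dimension is empty. -/
def sphereRank (m j : ℤ) : ℕ :=
  if m < 0 then 0 else (if j = 0 then 1 else 0) + (if j = m then 1 else 0)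

/-- `L` is an `R`-homology `n`-manifold: it is locally finite, and the link of every `i`-simplex
(a simplex with `i + 1` vertices) has the `R`-homology of an `(n - i - 1)`-sphere. -/
structure IsHomologyManifold (n : ℕ) (L : AbstractSimplicialComplex V) : Prop where
  locallyFinite : LocallyFinite L.toPreAbstractSimplicialComplex
  link_homology : ∀ s ∈ L, ∀ j : ℤ,
    Nonempty (Homology (link L.toPreAbstractSimplicialComplex s) R j ≃ₗ[R]
      (Fin (sphereRank ((n : ℤ) - ((s.card : ℤ) - 1) - 1) j) → R))

/-- An orientation of `K` in dimension `n`: an orientation of each `n`-simplex (a sign for each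
ordering of its vertices, alternating under permutations), such that any two `n`-simplices which
share an `(n - 1)`-simplex `w` induce opposite orientations on it. -/
@[ext]
structure Orientation (n : ℕ) where
  /-- The sign of an ordered `n`-simplex. -/
  sgn : {x : Fin (n + 1) → V // IsOrderedSimplex K x} → ℤˣ
  alternating : ∀ (x : Fin (n + 1) → V) (π : Equiv.Perm (Fin (n + 1)))
    (hx : IsOrderedSimplex K x) (hπ : IsOrderedSimplex K (x ∘ π)),
    sgn ⟨x ∘ π, hπ⟩ = Equiv.Perm.sign π * sgn ⟨x, hx⟩
  consistent : ∀ (w : Fin n → V) (a b : V)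
    (ha : IsOrderedSimplex K (Fin.cons a w : Fin (n + 1) → V))
    (hb : IsOrderedSimplex K (Fin.cons b w : Fin (n + 1) → V)),
    IsOrderedSimplex K w → a ≠ b → sgn ⟨Fin.cons a w, ha⟩ = - sgn ⟨Fin.cons b w, hb⟩

/-! ### Group actions -/

variable (Γ : Type w) [Group Γ] [MulAction Γ V]

/-- The action of `Γ` on the vertices sends simplices to simplices. -/
class IsSimplicialAction : Prop where
  map_mem : ∀ (γ : Γ), ∀ s ∈ K, s.map (MulAction.toPerm γ : Equiv.Perm V).toEmbedding ∈ K

/-- A simplicial action is free when it is free on the topological realisation, that is, when only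
the identity maps some simplex onto itself. -/
def IsFreeAction : Prop :=
  ∀ (γ : Γ), ∀ s ∈ K, s.map (MulAction.toPerm γ : Equiv.Perm V).toEmbedding = s → γ = 1

variable {K Γ}

theorem IsOrderedSimplex.smul [IsSimplicialAction K Γ] (γ : Γ) {k : ℕ} {x : Fin k → V}
    (hx : IsOrderedSimplex K x) : IsOrderedSimplex K (γ • x) := by
  classical
  refine ⟨(MulAction.injective γ).comp hx.1, ?_⟩
  have h := IsSimplicialAction.map_mem γ _ hx.2
  rw [Finset.map_eq_image, Finset.image_image] at h
  exact h

theorem isOrderedSimplex_smul_iff [IsSimplicialAction K Γ] (γ : Γ) {k : ℕ} {x : Fin k → V} :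
    IsOrderedSimplex K (γ • x) ↔ IsOrderedSimplex K x :=
  ⟨fun h => by simpa using h.smul γ⁻¹, fun h => h.smul γ⟩

/-- `Γ` acts on the orientations of `K`. -/
instance [IsSimplicialAction K Γ] (n : ℕ) : MulAction Γ (Orientation K n) where
  smul γ o :=
    { sgn := fun x => o.sgn ⟨γ⁻¹ • x.1, x.2.smul γ⁻¹⟩
      alternating := fun x π hx hπ => o.alternating (γ⁻¹ • x) π (hx.smul γ⁻¹) (hπ.smul γ⁻¹)
      consistent := fun w a b ha hb hw hab => by
        have e : ∀ c : V, γ⁻¹ • (Fin.cons c w : Fin (n + 1) → V) = Fin.cons (γ⁻¹ • c) (γ⁻¹ • w) :=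
          fun c => by
            ext j
            refine Fin.cases ?_ (fun j => ?_) j <;> simp
        have := o.consistent (γ⁻¹ • w) (γ⁻¹ • a) (γ⁻¹ • b) (e a ▸ ha.smul γ⁻¹)
          (e b ▸ hb.smul γ⁻¹) (hw.smul γ⁻¹) (fun h => hab (MulAction.injective γ⁻¹ h))
        simpa only [e] using this }
  one_smul o := by
    ext1; funext x
    change o.sgn _ = o.sgn _
    congr 2
    simp
  mul_smul a b o := by
    ext1; funext x
    change o.sgn _ = o.sgn _
    congr 2
    simp [mul_smul]

variable (K Γ)

open Classical in
/-- The sign by which each element of `Γ` permutes the orientations of `K`. A connected manifold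
has two orientations or none: if there are two, the sign of `γ` is `-1` if `γ` exchanges them and
`1` if it preserves them; if there are none, it is `1`. (It is set to `1` also when there are
infinitely many orientations.) -/
def orientationCharacter [IsSimplicialAction K Γ] (n : ℕ) : Γ →* ℤˣ :=
  if _h : Finite (Orientation K n) then
    haveI := Fintype.ofFinite (Orientation K n)
    Equiv.Perm.sign.comp (MulAction.toPermHom Γ (Orientation K n))
  else 1

open Classical in
theorem orientationCharacter_apply [IsSimplicialAction K Γ] (n : ℕ)
    (h : Nat.card (Orientation K n) = 2) (γ : Γ) :
    orientationCharacter K Γ n γ = if ∀ o : Orientation K n, γ • o = o then 1 else -1 := by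
  have hfin : Finite (Orientation K n) := Nat.finite_of_card_ne_zero (by omega)
  let := Fintype.ofFinite (Orientation K n)
  have hc : (Finset.univ : Finset (Orientation K n)).card = 2 := by
    rw [Finset.card_univ, ← Nat.card_eq_fintype_card, h]
  obtain ⟨a, b, hab, hu⟩ := Finset.card_eq_two.1 hc
  have hall : ∀ o : Orientation K n, o = a ∨ o = b := fun o => by
    have := Finset.mem_univ o
    rw [hu] at this
    simpa using this
  rw [orientationCharacter, dif_pos hfin]
  simp only [MonoidHom.comp_apply]
  split_ifs with hγ
  · have : MulAction.toPermHom Γ (Orientation K n) γ = 1 := Equiv.ext hγ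
    rw [this, map_one]
  · have : MulAction.toPermHom Γ (Orientation K n) γ = Equiv.swap a b := by
      have inj := MulAction.injective (β := Orientation K n) γ
      have key : γ • a = b ∧ γ • b = a := by
        rcases hall (γ • a) with h1 | h1 <;> rcases hall (γ • b) with h2 | h2
        · exact absurd (inj (h1.trans h2.symm)) hab
        · exact absurd (fun o => by rcases hall o with rfl | rfl <;> assumption) hγ
        · exact ⟨h1, h2⟩
        · exact absurd (inj (h1.trans h2.symm)) hab
      ext1 o
      rcases hall o with rfl | rfl
      · simpa using key.1
      · simpa using key.2
    rw [this, Equiv.Perm.sign_swap hab]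

/-! ### Right modules over the group algebra

A right `RΓ`-module is a representation over `R` of the opposite group of `Γ`. -/

/-- The orientation module `R°`: the right `RΓ`-module `R` on which `γ` acts as multiplication by
its sign on the orientations of `K`. -/
def orientationModule [IsSimplicialAction K Γ] (n : ℕ) : Representation R Γᵐᵒᵖ R where
  toFun γ := ((orientationCharacter K Γ n γ.unop : ℤˣ) : ℤ) • LinearMap.id
  map_one' := by ext; simp
  map_mul' a b := by
    ext
    simp [mul_comm]

/-- The right action on functions of tuples of vertices, `(f · γ)(x) = f (γ x)`. -/
def functionRep (k : ℕ) : Representation R Γᵐᵒᵖ ((Fin k → V) → R) where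
  toFun γ := LinearMap.funLeft R R fun x => γ.unop • x
  map_one' := by
    ext f x
    simp [LinearMap.funLeft_apply]
  map_mul' a b := by
    ext f x
    simp [LinearMap.funLeft_apply, mul_smul]

/-- The right action on finitely supported functions of tuples of vertices obtained from the left
action on tuples: `x · γ = γ⁻¹ x`. -/
def finsuppRep (k : ℕ) : Representation R Γᵐᵒᵖ ((Fin k → V) →₀ R) where
  toFun γ := Finsupp.lmapDomain R R fun x => γ.unop⁻¹ • x
  map_one' := by
    ext x : 2
    simp
  map_mul' a b := by
    ext x : 2
    simp [mul_smul]

theorem finsuppRep_apply (k : ℕ) (γ : Γᵐᵒᵖ) (c : (Fin k → V) →₀ R) (x : Fin k → V) :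
    finsuppRep R Γ k γ c x = c (γ.unop • x) := by
  have : x = γ.unop⁻¹ • (γ.unop • x) := by simp
  conv_lhs => rw [this]
  exact Finsupp.mapDomain_apply (MulAction.injective γ.unop⁻¹) c _

variable {K R Γ}

theorem functionRep_mem_cochains [IsSimplicialAction K Γ] {k : ℕ} (γ : Γᵐᵒᵖ)
    {f : (Fin k → V) → R} (hf : f ∈ cochains K R k) :
    functionRep R Γ k γ f ∈ cochains K R k :=
  ⟨fun _ hx => hf.1 _ fun h => hx ((isOrderedSimplex_smul_iff γ.unop).1 h),
    fun x π => hf.2 (γ.unop • x) π⟩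

theorem functionRep_mem_compactCochains [IsSimplicialAction K Γ] {k : ℕ} (γ : Γᵐᵒᵖ)
    {f : (Fin k → V) → R} (hf : f ∈ compactCochains K R k) :
    functionRep R Γ k γ f ∈ compactCochains K R k :=
  ⟨functionRep_mem_cochains γ hf.1, hf.2.preimage (MulAction.injective γ.unop).injOn⟩

open Classical in
theorem coboundary_functionRep [IsSimplicialAction K Γ] {k : ℕ} (γ : Γᵐᵒᵖ)
    (f : (Fin k → V) → R) :
    coboundary K R k (functionRep R Γ k γ f) =
      functionRep R Γ (k + 1) γ (coboundary K R k f) := by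
  ext x
  have h := isOrderedSimplex_smul_iff (K := K) γ.unop (x := x)
  change (if IsOrderedSimplex K x then _ else _) =
    (if IsOrderedSimplex K (γ.unop • x) then _ else _)
  simp only [h]
  rfl

theorem finsuppRep_mem_chains [IsSimplicialAction K Γ] {k : ℕ} (γ : Γᵐᵒᵖ)
    {c : (Fin k → V) →₀ R} (hc : c ∈ chains K R k) : finsuppRep R Γ k γ c ∈ chains K R k := by
  have h : (⇑(finsuppRep R Γ k γ c) : (Fin k → V) → R) = functionRep R Γ k γ c :=
    funext fun x => finsuppRep_apply R Γ k γ c x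
  change (⇑(finsuppRep R Γ k γ c) : (Fin k → V) → R) ∈ cochains K R k
  rw [h]
  exact functionRep_mem_cochains γ hc

theorem boundary_finsuppRep [IsSimplicialAction K Γ] {k : ℕ} (γ : Γᵐᵒᵖ)
    (c : (Fin (k + 1) → V) →₀ R) :
    boundary K R k (finsuppRep R Γ (k + 1) γ c) = finsuppRep R Γ k γ (boundary K R k c) := by
  suffices h : boundary K R k ∘ₗ finsuppRep R Γ (k + 1) γ =
      finsuppRep R Γ k γ ∘ₗ boundary K R k from LinearMap.congr_fun h c
  ext x : 2
  have e : Fin.tail (γ.unop⁻¹ • x) = γ.unop⁻¹ • Fin.tail x := rfl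
  by_cases h : IsOrderedSimplex K (Fin.tail x) <;>
    simp [boundary, finsuppRep, e, isOrderedSimplex_smul_iff, h]

theorem cycles_le_comap [IsSimplicialAction K Γ] (k : ℕ) (γ : Γᵐᵒᵖ) :
    cycles K R k ≤ (cycles K R k).comap (finsuppRep R Γ k γ) := by
  intro c hc
  cases k with
  | zero => exact finsuppRep_mem_chains γ hc
  | succ k =>
    refine ⟨finsuppRep_mem_chains γ hc.1, ?_⟩
    have h : boundary K R k c = 0 := hc.2
    change boundary K R k _ = 0
    rw [boundary_finsuppRep, h, map_zero]

theorem boundaries_le_comap [IsSimplicialAction K Γ] (k : ℕ) (γ : Γᵐᵒᵖ) :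
    boundaries K R k ≤ (boundaries K R k).comap (finsuppRep R Γ k γ) := by
  rintro _ ⟨c, hc, rfl⟩
  exact ⟨_, finsuppRep_mem_chains γ hc, boundary_finsuppRep γ c⟩

theorem cocycles_le_comap [IsSimplicialAction K Γ] (k : ℕ) (γ : Γᵐᵒᵖ) :
    cocycles K R k ≤ (cocycles K R k).comap (functionRep R Γ k γ) := by
  intro f hf
  refine ⟨functionRep_mem_compactCochains γ hf.1, ?_⟩
  have h : coboundary K R k f = 0 := hf.2
  change coboundary K R k _ = 0
  rw [coboundary_functionRep, h, map_zero]

theorem coboundaries_le_comap [IsSimplicialAction K Γ] (k : ℕ) (γ : Γᵐᵒᵖ) :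
    coboundaries K R k ≤ (coboundaries K R k).comap (functionRep R Γ k γ) := by
  intro f hf
  cases k with
  | zero =>
    have h : f = 0 := hf
    change functionRep R Γ 0 γ f = 0
    rw [h, map_zero]
  | succ k =>
    obtain ⟨g, hg, rfl⟩ := hf
    exact ⟨_, functionRep_mem_compactCochains γ hg, coboundary_functionRep γ g⟩

variable (K R Γ)

/-- The representation induced on a subquotient by invariant submodules. -/
def subquotientRep {R : Type v} [CommRing R] {G : Type w} [Monoid G] {M : Type u} [AddCommGroup M]
    [Module R M] (ρ : Representation R G M) (Z B : Submodule R M)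
    (hZ : ∀ g, Z ≤ Z.comap (ρ g)) (hB : ∀ g, B ≤ B.comap (ρ g)) :
    Representation R G (Subquotient Z B) :=
  (ρ.subrepresentation Z hZ).quotient (B.comap Z.subtype) fun g _ hz => hB g hz

/-- `H_i(K; R)` as a right `RΓ`-module. -/
def homologyRep [IsSimplicialAction K Γ] (i : ℤ) : Representation R Γᵐᵒᵖ (Homology K R i) :=
  subquotientRep (finsuppRep R Γ (i + 1).toNat) _ _ (cycles_le_comap _) (boundaries_le_comap _)

/-- `H_c^i(K; R)` as a right `RΓ`-module. -/
def compactCohomologyRep [IsSimplicialAction K Γ] (i : ℤ) :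
    Representation R Γᵐᵒᵖ (CompactCohomology K R i) :=
  subquotientRep (functionRep R Γ (i + 1).toNat) _ _ (cocycles_le_comap _)
    (coboundaries_le_comap _)

end HomologyManifold

end

/-! The duality comes from a double complex with two differentials, one computing homology and the
other cohomology with compact supports. `flagChains` consists of finitely supported functions of
pairs (face `x` with `a` vertices, simplex `y` with `b` vertices containing `x`), alternating in
both. `faceDiff` is the coboundary in `x`, and `simplexDiff` is the boundary in `y` with the
simplices not containing `x` discarded.

For a fixed `y`, a row is the augmented cochain complex of a full simplex. It is contractible
(`exists_faceDiff_eq`, `eq_zero_of_faceDiff_eq_zero`), and its term `a = 0` is the chain group of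
`K`. For a fixed nonempty `x`, a column is the augmented chain complex of the link of `x`, shifted
by `a`. Since the link has the homology of an `(n - a)`-sphere, the column is exact except at `b = n
+ 1` (`HasSphericalLinks.exists_simplexDiff_eq`). There its cycles are the multiples of the
restriction to the star of `x` of a fundamental class `ω` (`exists_eq_smul_starClass`). A finitely
supported family of such multiples is a compactly supported cochain times `ω`, and `faceDiff` acts
on it as the coboundary (`faceDiff_mulClass`).

Hence a homology class in degree `n - i` can be carried up the staircase of the double complex, one
step at a time (`corresponds_step`), until it becomes a compactly supported cohomology class in
degree `i`. Each step involves choices, so it is recorded as a linear relation (`Corresponds`).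
Relations compose, can be stable under the group although no choice is, and induce isomorphisms of
subquotients (`Corresponds.exists_linearEquiv`).

Everything is equivariant except multiplication by `ω`. An orientation provides `ω`, and the
constant function `1` on top simplices does so when `2 = 0` in `R`. On a connected manifold an
orientation is unique up to sign, so `γ` multiplies `ω` by its orientation sign
(`exists_isFundamentalClass`). This sign is the twist by the orientation module. -/

noncomputable section

namespace HomologyManifold

universe u v w

/-! ### Alternating functions of tuples -/

section Alternating

variable {V M : Type*} [AddCommGroup M]

/-- Functions of tuples that change by the sign of the permutation when the entries are permuted. -/
def IsAlternating {k : ℕ} (f : (Fin k → V) → M) : Prop :=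
  ∀ x (π : Equiv.Perm (Fin k)), f (x ∘ π) = (Equiv.Perm.sign π : ℤ) • f x

/-- The alternating sum of the values of `F` on the tuples obtained from `z` by omitting an
entry. -/
def faceSum {k : ℕ} (F : (Fin k → V) → M) (z : Fin (k + 1) → V) : M :=
  ∑ j : Fin (k + 1), (-1 : ℤ) ^ (j : ℕ) • F (z ∘ j.succAbove)

theorem cons_comp_perm {k : ℕ} (v : V) (x : Fin k → V) (π : Equiv.Perm (Fin k)) :
    (Fin.cons v (x ∘ π) : Fin (k + 1) → V) =
      (Fin.cons v x : Fin (k + 1) → V) ∘ Equiv.Perm.decomposeFin.symm (0, π) := by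
  ext j
  refine Fin.cases ?_ (fun j => ?_) j <;> simp

theorem sign_decomposeFin_zero {k : ℕ} (π : Equiv.Perm (Fin k)) :
    Equiv.Perm.sign (Equiv.Perm.decomposeFin.symm (0, π)) = Equiv.Perm.sign π := by
  simp [Equiv.Perm.decomposeFin.symm_sign]

theorem IsAlternating.cons {k : ℕ} {f : (Fin (k + 1) → V) → M} (hf : IsAlternating f) (v : V) :
    IsAlternating fun x : Fin k → V => f (Fin.cons v x) := by
  intro x π
  simp only [cons_comp_perm, hf (Fin.cons v x), sign_decomposeFin_zero]

theorem cons_cons_comp_swap {k : ℕ} (u v : V) (x : Fin k → V) :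
    (Fin.cons u (Fin.cons v x : Fin (k + 1) → V) : Fin (k + 2) → V) ∘ Equiv.swap 0 1 =
      Fin.cons v (Fin.cons u x : Fin (k + 1) → V) := by
  ext j
  refine Fin.cases ?_ (fun j => ?_) j
  · simp only [Function.comp, Equiv.swap_apply_left]
    rfl
  · refine Fin.cases ?_ (fun j => ?_) j
    · have : (Fin.succ 0 : Fin (k + 2)) = 1 := rfl
      simp [this]
    · have h : Equiv.swap (0 : Fin (k + 2)) 1 j.succ.succ = j.succ.succ :=
        Equiv.swap_apply_of_ne_of_ne (Fin.succ_ne_zero _)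
          (fun h => Fin.succ_ne_zero j (Fin.succ_injective _ h))
      simp [h]

theorem IsAlternating.cons_cons {k : ℕ} {f : (Fin (k + 2) → V) → M} (hf : IsAlternating f)
    (u v : V) (x : Fin k → V) :
    f (Fin.cons u (Fin.cons v x : Fin (k + 1) → V)) =
      - f (Fin.cons v (Fin.cons u x : Fin (k + 1) → V)) := by
  rw [← cons_cons_comp_swap u v x, hf, Equiv.Perm.sign_swap (by simp)]
  simp

/-- Adjacent transpositions generate the symmetric group. The first is covered by `h₂`; the others
fix position `0` and are covered by `h₁`. -/
theorem isAlternating_of_cons {k : ℕ} {f : (Fin (k + 2) → V) → M}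
    (h₁ : ∀ v, IsAlternating fun x : Fin (k + 1) → V => f (Fin.cons v x))
    (h₂ : ∀ u v (x : Fin k → V), f (Fin.cons u (Fin.cons v x : Fin (k + 1) → V)) =
      - f (Fin.cons v (Fin.cons u x : Fin (k + 1) → V))) : IsAlternating f := by
  have key : ∀ π : Equiv.Perm (Fin (k + 2)),
      ∀ x, f (x ∘ π) = (Equiv.Perm.sign π : ℤ) • f x := by
    intro π
    have hπ : π ∈ Submonoid.closure
        (Set.range fun i : Fin (k + 1) => Equiv.swap i.castSucc i.succ) := by
      rw [Equiv.Perm.mclosure_swap_castSucc_succ]; trivial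
    induction hπ using Submonoid.closure_induction with
    | mem π hπ =>
      obtain ⟨i, rfl⟩ := hπ
      intro x
      dsimp only
      rw [Equiv.Perm.sign_swap (Fin.castSucc_lt_succ (i := i)).ne]
      revert x
      refine Fin.cases ?_ (fun i => ?_) i <;> intro x
      · obtain ⟨u, y, rfl⟩ : ∃ u y, x = Fin.cons u y := ⟨x 0, Fin.tail x, by simp⟩
        obtain ⟨v, y, rfl⟩ : ∃ v z, y = Fin.cons v z := ⟨y 0, Fin.tail y, by simp⟩
        have := cons_cons_comp_swap u v y
        simp only [Fin.castSucc_zero, Fin.succ_zero_eq_one]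
        rw [this, h₂]
        simp
      · obtain ⟨u, y, rfl⟩ : ∃ u y, x = Fin.cons u y := ⟨x 0, Fin.tail x, by simp⟩
        have e : Equiv.swap i.succ.castSucc i.succ.succ =
            Equiv.Perm.decomposeFin.symm (0, Equiv.swap i.castSucc i.succ) := by
          ext j : 1
          refine Fin.cases ?_ (fun j => ?_) j
          · rw [Equiv.swap_apply_of_ne_of_ne] <;> simp [Fin.ext_iff]
          · simp only [Equiv.Perm.decomposeFin_symm_apply_succ, Equiv.swap_self, Equiv.refl_apply,
              Equiv.swap_apply_def, Fin.ext_iff, Fin.val_succ, Fin.val_castSucc]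
            split_ifs <;> simp_all
        have h := h₁ u y (Equiv.swap i.castSucc i.succ)
        rw [Equiv.Perm.sign_swap (Fin.castSucc_lt_succ (i := i)).ne] at h
        rw [e, ← cons_comp_perm]
        exact h
    | one => simp
    | mul π ρ _ _ hπ hρ =>
      intro x
      rw [Equiv.Perm.coe_mul, ← Function.comp_assoc, hρ, hπ, smul_smul, map_mul]
      simp [mul_comm]
  exact fun x π => key π x

/-- This recursion on the first entry replaces index manipulations with `succAbove` by inductions on
`k`. -/
theorem faceSum_cons {k : ℕ} (F : (Fin (k + 1) → V) → M) (v : V) (z : Fin (k + 1) → V) :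
    faceSum F (Fin.cons v z : Fin (k + 2) → V) =
      F z - faceSum (fun x : Fin k → V => F (Fin.cons v x)) z := by
  rw [faceSum, Fin.sum_univ_succ, faceSum, sub_eq_add_neg, ← Finset.sum_neg_distrib]
  congr 1
  · simp only [Fin.val_zero, pow_zero, one_smul]
    congr 1
  · refine Finset.sum_congr rfl fun j _ => ?_
    rw [Fin.val_succ, pow_succ, mul_neg_one, neg_smul]
    congr 3
    ext i
    refine Fin.cases ?_ (fun i => ?_) i <;> simp

theorem faceSum_faceSum {k : ℕ} (F : (Fin k → V) → M) (z : Fin (k + 2) → V) :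
    faceSum (faceSum F) z = 0 := by
  induction k with
  | zero =>
    simp only [faceSum]
    simp [Subsingleton.elim _ (default : Fin 0 → V)]
  | succ k ih =>
    obtain ⟨v, z, rfl⟩ : ∃ v y, z = Fin.cons v y := ⟨z 0, Fin.tail z, by simp⟩
    have : (fun x : Fin (k + 1) → V => faceSum F (Fin.cons v x : Fin (k + 2) → V)) =
        fun x => F x - faceSum (fun y : Fin k → V => F (Fin.cons v y)) x :=
      funext fun x => faceSum_cons F v x
    rw [faceSum_cons, this]
    have h := ih (fun y : Fin k → V => F (Fin.cons v y)) z
    simp only [faceSum, smul_sub, Finset.sum_sub_distrib] at h ⊢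
    rw [h]
    simp

theorem IsAlternating.faceSum {k : ℕ} {F : (Fin k → V) → M} (hF : IsAlternating F) :
    IsAlternating (faceSum F) := by
  induction k with
  | zero =>
    intro x π
    rw [Subsingleton.elim (α := Equiv.Perm (Fin 1)) π 1]
    simp
  | succ k ih =>
    refine isAlternating_of_cons (fun v x π => ?_) fun u v x => ?_
    · simp only [faceSum_cons]
      rw [hF, ih (hF.cons v), smul_sub]
    · rw [faceSum_cons, faceSum_cons]
      cases k with
      | zero =>
        simp only [HomologyManifold.faceSum]
        simp [Subsingleton.elim _ (default : Fin 0 → V)]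
      | succ k =>
        rw [faceSum_cons, faceSum_cons]
        have : (fun y : Fin k → V => F (Fin.cons u (Fin.cons v y : Fin (k + 1) → V))) =
            fun y => - F (Fin.cons v (Fin.cons u y : Fin (k + 1) → V)) :=
          funext fun y => hF.cons_cons u v y
        rw [this]
        simp only [HomologyManifold.faceSum, smul_neg, Finset.sum_neg_distrib]
        abel

theorem exists_perm_of_ne {k : ℕ} {i j : Fin (k + 2)} (h : i ≠ j) :
    ∃ π : Equiv.Perm (Fin (k + 2)), π 0 = i ∧ π 1 = j := by
  refine ⟨Equiv.swap (Equiv.swap 0 i 1) j * Equiv.swap 0 i, ?_, ?_⟩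
  · rw [Equiv.Perm.mul_apply, Equiv.swap_apply_left, Equiv.swap_apply_of_ne_of_ne _ h]
    intro h'
    exact absurd ((Equiv.swap (0 : Fin (k + 2)) i).injective
      ((Equiv.swap_apply_left 0 i).trans h')) (by simp)
  · rw [Equiv.Perm.mul_apply, Equiv.swap_apply_left]

/-- Alternation alone gives only `2 • F = 0` at repeated entries. Instead, a permutation moves two
equal entries to positions `0` and `1`; omitting either gives the same value with opposite signs,
and all other faces still have a repetition. -/
theorem faceSum_eq_zero_of_not_injective {k : ℕ} {F : (Fin k → V) → M} (hF : IsAlternating F)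
    (h0 : ∀ x, ¬ Function.Injective x → F x = 0) (z : Fin (k + 1) → V)
    (hz : ¬ Function.Injective z) : faceSum F z = 0 := by
  simp only [Function.Injective, not_forall] at hz
  obtain ⟨i, j, hij, hne⟩ := hz
  cases k with
  | zero => exact absurd (Subsingleton.elim (α := Fin 1) i j) hne
  | succ k =>
    obtain ⟨π, rfl, rfl⟩ := exists_perm_of_ne hne
    have h : HomologyManifold.faceSum F (z ∘ π) = 0 := by
      obtain ⟨u, y, hy⟩ : ∃ u y, z ∘ π = Fin.cons u y := ⟨_, _, (Fin.cons_self_tail _).symm⟩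
      obtain ⟨v, x, rfl⟩ : ∃ v x, y = Fin.cons v x := ⟨_, _, (Fin.cons_self_tail _).symm⟩
      have huv : u = v := by
        have h0 := congrFun hy 0
        have h1 := congrFun hy 1
        have e : (Fin.cons u (Fin.cons v x : Fin (k + 1) → V) : Fin (k + 2) → V) 1 = v := rfl
        simp only [Function.comp, Fin.cons_zero] at h0
        rw [e] at h1
        exact h0.symm.trans (hij.trans h1)
      subst huv
      rw [hy, faceSum_cons]
      cases k with
      | zero =>
        simp only [HomologyManifold.faceSum]
        simp
      | succ k =>
        rw [faceSum_cons]
        have : (fun y : Fin k → V => F (Fin.cons u (Fin.cons u y : Fin (k + 1) → V))) =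
            fun _ => 0 := funext fun y => h0 _ fun hi =>
              absurd (hi (a₁ := 0) (a₂ := 1) rfl) (by simp)
        rw [this]
        simp [HomologyManifold.faceSum]
    rw [hF.faceSum] at h
    rcases Int.units_eq_one_or (Equiv.Perm.sign π) with e | e <;> simpa [e] using h

/-! ### Reorderings of tuples and alternating extensions -/

theorem exists_perm_of_range_eq {k : ℕ} {x y : Fin k → V} (hx : Function.Injective x)
    (hy : Function.Injective y) (h : Set.range x = Set.range y) :
    ∃ π : Equiv.Perm (Fin k), y = x ∘ π := by
  refine ⟨(Equiv.ofInjective y hy).trans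
    ((Equiv.setCongr h.symm).trans (Equiv.ofInjective x hx).symm), ?_⟩
  ext i
  simp only [Function.comp, Equiv.trans_apply]
  exact congrArg Subtype.val ((Equiv.ofInjective x hx).apply_symm_apply
    ((Equiv.setCongr h.symm) (Equiv.ofInjective y hy i))).symm

/-- A function on a set of tuples which is compatible with permutations extends to an alternating
function which is zero on the tuples that are no permutations of tuples in the set. -/
theorem exists_isAlternating_extension {k : ℕ} (P : Set (Fin k → V)) (h : (Fin k → V) → M)
    (hP : ∀ y ∈ P, ∀ π : Equiv.Perm (Fin k), y ∘ π ∈ P →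
      h (y ∘ π) = (Equiv.Perm.sign π : ℤ) • h y) :
    ∃ c : (Fin k → V) → M, IsAlternating c ∧ (∀ y ∈ P, c y = h y) ∧
      ∀ y, (∀ π : Equiv.Perm (Fin k), y ∘ π ∉ P) → c y = 0 := by
  classical
  have hsq : ∀ π : Equiv.Perm (Fin k), (Equiv.Perm.sign π : ℤ) * (Equiv.Perm.sign π : ℤ) = 1 :=
    fun π => by rcases Int.units_eq_one_or (Equiv.Perm.sign π) with e | e <;> simp [e]
  let c : (Fin k → V) → M := fun y =>
    if H : ∃ π : Equiv.Perm (Fin k), y ∘ π ∈ P then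
      (Equiv.Perm.sign H.choose : ℤ) • h (y ∘ H.choose) else 0
  -- The compatibility `hP` makes the value independent of the chosen reordering.
  have hc : ∀ y (π : Equiv.Perm (Fin k)), y ∘ π ∈ P →
      c y = (Equiv.Perm.sign π : ℤ) • h (y ∘ π) := by
    intro y π hπ
    have H : ∃ π : Equiv.Perm (Fin k), y ∘ π ∈ P := ⟨π, hπ⟩
    have e : y ∘ H.choose = (y ∘ π) ∘ (π⁻¹ * H.choose : Equiv.Perm (Fin k)) := by
      ext i; simp
    have h1 := hP _ hπ (π⁻¹ * H.choose) (e ▸ H.choose_spec)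
    simp only [c, dif_pos H]
    rw [e, h1, smul_smul, map_mul, map_inv, Units.val_mul, Int.units_inv_eq_self]
    congr 1
    rw [mul_left_comm, hsq, mul_one]
  refine ⟨c, fun y π => ?_, fun y hy => ?_, fun y hy => ?_⟩
  · by_cases H : ∃ ρ : Equiv.Perm (Fin k), y ∘ ρ ∈ P
    · obtain ⟨ρ, hρ⟩ := H
      have e : y ∘ ρ = (y ∘ π) ∘ (π⁻¹ * ρ : Equiv.Perm (Fin k)) := by
        ext i; simp
      rw [hc y ρ hρ, hc (y ∘ π) (π⁻¹ * ρ) (e ▸ hρ), ← e, smul_smul, map_mul, map_inv,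
        Units.val_mul, Int.units_inv_eq_self]
    · have H' : ¬ ∃ ρ : Equiv.Perm (Fin k), (y ∘ π) ∘ ρ ∈ P := fun ⟨ρ, hρ⟩ =>
        H ⟨π * ρ, by rwa [Function.comp_assoc] at hρ⟩
      simp only [c, dif_neg H, dif_neg H', smul_zero]
  · have := hc y 1 (by simpa using hy)
    simpa using this
  · exact dif_neg fun ⟨π, hπ⟩ => hy π hπ

/-- A choice of one ordering for each unordered tuple. -/
theorem exists_orderings (V : Type*) (k : ℕ) : ∃ P : Set (Fin k → V),
    (∀ y ∈ P, ∀ π : Equiv.Perm (Fin k), y ∘ π ∈ P → y ∘ π = y) ∧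
      ∀ y : Fin k → V, ∃ π : Equiv.Perm (Fin k), y ∘ π ∈ P := by
  let S : Setoid (Fin k → V) :=
    { r := fun x y => ∃ π : Equiv.Perm (Fin k), x ∘ π = y
      iseqv := ⟨fun x => ⟨1, rfl⟩, fun {x y} ⟨π, h⟩ => ⟨π⁻¹, by rw [← h]; ext; simp⟩,
        fun {x y z} ⟨π, h⟩ ⟨ρ, h'⟩ => ⟨π * ρ, by rw [← h', ← h]; rfl⟩⟩ }
  refine ⟨Set.range (Quotient.out (s := S)), ?_, fun y => ?_⟩
  · rintro _ ⟨p, rfl⟩ π ⟨q, hq⟩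
    have : q = p := by
      rw [← Quotient.out_eq q, ← Quotient.out_eq p]
      exact Quotient.sound ⟨π⁻¹, by rw [hq]; ext; simp⟩
    rw [← hq, this]
  · obtain ⟨π, h⟩ : S.r y (Quotient.mk S y).out := Setoid.symm (Quotient.mk_out (s := S) y)
    exact ⟨π, _, h.symm⟩

/-- Functions of injective tuples can be corrected to be alternating, using their values on one
ordering of each unordered tuple. -/
theorem exists_isAlternating {k : ℕ} (h : (Fin k → V) → M) :
    ∃ c : (Fin k → V) → M, IsAlternating c ∧
      (∀ y, ¬ Function.Injective y → c y = 0) ∧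
      ∀ y, Function.Injective y → ∃ π : Equiv.Perm (Fin k),
        c y = (Equiv.Perm.sign π : ℤ) • h (y ∘ π) := by
  obtain ⟨P, hP, hP'⟩ := exists_orderings V k
  obtain ⟨c, hc, hc1, hc0⟩ := exists_isAlternating_extension
    (P ∩ {y | Function.Injective y}) h fun y hy π hyπ => by
      have e := hP y hy.1 π hyπ.1
      have : π = 1 := Equiv.ext fun i => hy.2 (congrFun e i)
      subst this
      simp
  refine ⟨c, hc, fun y hy => hc0 y fun π hπ => hy ?_, fun y hy => ?_⟩
  · have := hπ.2.comp π.symm.injective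
    simpa [Function.comp_assoc] using this
  · obtain ⟨π, hπ⟩ := hP' y
    refine ⟨π, ?_⟩
    rw [← hc1 _ ⟨hπ, hy.comp π.injective⟩, hc, smul_smul]
    rcases Int.units_eq_one_or (Equiv.Perm.sign π) with e | e <;> simp [e]

end Alternating

/-! ### Correspondences between subquotients of representations -/

section Corresponds

variable {R G M N P : Type*} [CommRing R] [Monoid G] [AddCommGroup M] [Module R M]
  [AddCommGroup N] [Module R N] [AddCommGroup P] [Module R P]

/-- The subquotients `Z / B` and `Z' / B'` correspond to each other under a linear relation which
is compatible with the actions of `G` up to the factors `χ`. -/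
def Corresponds (χ : G → R) (ρ : Representation R G M) (Z B : Submodule R M)
    (σ : Representation R G N) (Z' B' : Submodule R N) : Prop :=
  ∃ W : Submodule R (M × N), (∀ p ∈ W, p.1 ∈ Z ∧ p.2 ∈ Z') ∧ (∀ z ∈ Z, ∃ z', (z, z') ∈ W) ∧
    (∀ z' ∈ Z', ∃ z, (z, z') ∈ W) ∧ (∀ p ∈ W, p.1 ∈ B ↔ p.2 ∈ B') ∧
    ∀ g, ∀ p ∈ W, (ρ g p.1, χ g • σ g p.2) ∈ W

/-- The relation is transposed; rescaling the pair `(ρ g p.1, χ g • σ g p.2)` by `χ g` moves the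
factor to the other side because `χ g` squares to one. -/
theorem Corresponds.symm {χ : G → R} {ρ : Representation R G M} {Z B : Submodule R M}
    {σ : Representation R G N} {Z' B' : Submodule R N} (h : Corresponds χ ρ Z B σ Z' B')
    (hχ : ∀ g, χ g * χ g = 1) : Corresponds χ σ Z' B' ρ Z B := by
  obtain ⟨W, h1, h2, h3, h4, h5⟩ := h
  refine ⟨W.comap (LinearEquiv.prodComm R N M).toLinearMap, fun p hp => (h1 _ hp).symm, h3, h2,
    fun p hp => (h4 _ hp).symm, fun g p hp => ?_⟩
  have := W.smul_mem (χ g) (h5 g _ hp)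
  simp only [Prod.smul_mk, smul_smul, hχ, one_smul] at this
  exact this

theorem Corresponds.trans {χ ψ : G → R} {ρ : Representation R G M} {Z B : Submodule R M}
    {σ : Representation R G N} {Z' B' : Submodule R N} {τ : Representation R G P}
    {Z'' B'' : Submodule R P} (h : Corresponds χ ρ Z B σ Z' B')
    (h' : Corresponds ψ σ Z' B' τ Z'' B'') :
    Corresponds (fun g => χ g * ψ g) ρ Z B τ Z'' B'' := by
  obtain ⟨W, h1, h2, h3, h4, h5⟩ := h
  obtain ⟨W', h1', h2', h3', h4', h5'⟩ := h'
  refine ⟨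
    { carrier := {p | ∃ m, (p.1, m) ∈ W ∧ (m, p.2) ∈ W'}
      zero_mem' := ⟨0, W.zero_mem, W'.zero_mem⟩
      add_mem' := fun {p q} ⟨m, hm, hm'⟩ ⟨m₁, hm₁, hm₁'⟩ =>
        ⟨m + m₁, W.add_mem hm hm₁, W'.add_mem hm' hm₁'⟩
      smul_mem' := fun r p ⟨m, hm, hm'⟩ => ⟨r • m, W.smul_mem r hm, W'.smul_mem r hm'⟩ },
    ?_, ?_, ?_, ?_, ?_⟩
  · rintro p ⟨m, hm, hm'⟩
    exact ⟨(h1 _ hm).1, (h1' _ hm').2⟩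
  · intro z hz
    obtain ⟨m, hm⟩ := h2 z hz
    obtain ⟨y, hy⟩ := h2' m (h1 _ hm).2
    exact ⟨y, m, hm, hy⟩
  · intro y hy
    obtain ⟨m, hm⟩ := h3' y hy
    obtain ⟨z, hz⟩ := h3 m (h1' _ hm).1
    exact ⟨z, m, hz, hm⟩
  · rintro p ⟨m, hm, hm'⟩
    exact (h4 _ hm).trans (h4' _ hm')
  · rintro g p ⟨m, hm, hm'⟩
    refine ⟨χ g • σ g m, h5 g _ hm, ?_⟩
    have := W'.smul_mem (χ g) (h5' g _ hm')
    simp only [Prod.smul_mk, smul_smul] at this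
    exact this

/-- An equivariant linear map inducing an isomorphism of subquotients. -/
theorem Corresponds.of_linearMap {χ : G → R} {ρ : Representation R G M} {Z B : Submodule R M}
    {σ : Representation R G N} {Z' B' : Submodule R N} (f : M →ₗ[R] N)
    (hZ : ∀ g, Z ≤ Z.comap (ρ g)) (h1 : ∀ z ∈ Z, f z ∈ Z')
    (h2 : ∀ z' ∈ Z', ∃ z ∈ Z, f z = z') (h3 : ∀ z ∈ Z, z ∈ B ↔ f z ∈ B')
    (h4 : ∀ g, ∀ z ∈ Z, f (ρ g z) = χ g • σ g (f z)) : Corresponds χ ρ Z B σ Z' B' := by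
  refine ⟨Z.map (LinearMap.id.prod f), ?_, ?_, ?_, ?_, ?_⟩
  · rintro _ ⟨z, hz, rfl⟩
    exact ⟨hz, h1 z hz⟩
  · exact fun z hz => ⟨f z, z, hz, rfl⟩
  · intro z' hz'
    obtain ⟨z, hz, rfl⟩ := h2 z' hz'
    exact ⟨z, z, hz, rfl⟩
  · rintro _ ⟨z, hz, rfl⟩
    exact h3 z hz
  · rintro g _ ⟨z, hz, rfl⟩
    exact ⟨ρ g z, hZ g hz, Prod.ext rfl (h4 g z hz)⟩

end Corresponds

/-- Both subquotients are quotients of the relation `W`, through its two projections, and the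
condition on `B` and `B'` says that the two kernels agree. -/
theorem Corresponds.exists_linearEquiv {R : Type v} {G : Type w} {M : Type u} {N : Type*}
    [CommRing R] [Monoid G] [AddCommGroup M] [Module R M] [AddCommGroup N] [Module R N]
    {χ : G → R} {ρ : Representation R G M}
    {Z B : Submodule R M} {σ : Representation R G N} {Z' B' : Submodule R N}
    (h : Corresponds χ ρ Z B σ Z' B')
    (hZ : ∀ g, Z ≤ Z.comap (ρ g)) (hB : ∀ g, B ≤ B.comap (ρ g))
    (hZ' : ∀ g, Z' ≤ Z'.comap (σ g)) (hB' : ∀ g, B' ≤ B'.comap (σ g)) :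
    ∃ e : Subquotient Z B ≃ₗ[R] Subquotient Z' B', ∀ g x,
      e (subquotientRep ρ Z B hZ hB g x) = χ g • subquotientRep σ Z' B' hZ' hB' g (e x) := by
  obtain ⟨W, h1, h2, h3, h4, h5⟩ := h
  let f : W →ₗ[R] Subquotient Z B := (Submodule.mkQ _).comp
    (((LinearMap.fst R M N).comp W.subtype).codRestrict Z fun p => (h1 p.1 p.2).1)
  let f' : W →ₗ[R] Subquotient Z' B' := (Submodule.mkQ _).comp
    (((LinearMap.snd R M N).comp W.subtype).codRestrict Z' fun p => (h1 p.1 p.2).2)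
  have hf : Function.Surjective f := by
    intro q
    obtain ⟨z, rfl⟩ := Submodule.mkQ_surjective _ q
    obtain ⟨z', hz'⟩ := h2 z.1 z.2
    exact ⟨⟨_, hz'⟩, rfl⟩
  have hf' : Function.Surjective f' := by
    intro q
    obtain ⟨z, rfl⟩ := Submodule.mkQ_surjective _ q
    obtain ⟨z', hz'⟩ := h3 z.1 z.2
    exact ⟨⟨_, hz'⟩, rfl⟩
  have hk : LinearMap.ker f = LinearMap.ker f' := by
    ext p
    simp only [f, f', LinearMap.mem_ker, LinearMap.comp_apply, Submodule.mkQ_apply,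
      Submodule.Quotient.mk_eq_zero, Submodule.mem_comap]
    exact h4 p.1 p.2
  let e : Subquotient Z B ≃ₗ[R] Subquotient Z' B' :=
    (f.quotKerEquivOfSurjective hf).symm.trans
      ((Submodule.quotEquivOfEq _ _ hk).trans (f'.quotKerEquivOfSurjective hf'))
  have he : ∀ p, e (f p) = f' p := by
    intro p
    have h0 : (f.quotKerEquivOfSurjective hf).symm (f p) = Submodule.Quotient.mk p := by
      rw [LinearEquiv.symm_apply_eq]
      rfl
    simp only [e, LinearEquiv.trans_apply, h0]
    rfl
  refine ⟨e, fun g x => ?_⟩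
  obtain ⟨p, rfl⟩ := hf x
  rw [he]
  have := he ⟨_, h5 g p.1 p.2⟩
  exact this

/-! ### The boundary of chains, and chains in stars -/

section Stars

variable {V : Type u} (K : PreAbstractSimplicialComplex V) (R : Type v) [CommRing R]

theorem finite_support_cons {k : ℕ} (c : (Fin (k + 1) → V) →₀ R) (w : Fin k → V) :
    (Function.support fun v => c (Fin.cons v w)).Finite :=
  c.hasFiniteSupport.preimage fun _ _ _ _ h => Fin.cons_left_injective (α := fun _ => V) w h

open Classical in
-- The pointwise formula is the form in which the boundary can be compared on stars and links.
theorem boundary_apply {k : ℕ} (c : (Fin (k + 1) → V) →₀ R) (w : Fin k → V) :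
    boundary K R k c w = if IsOrderedSimplex K w then ∑ᶠ v, c (Fin.cons v w) else 0 := by
  induction c using Finsupp.induction_linear with
  | zero => simp
  | add c d hc hd =>
    rw [map_add, Finsupp.add_apply, hc, hd]
    split_ifs
    · simp only [Finsupp.add_apply]
      rw [finsum_add_distrib (finite_support_cons R c w) (finite_support_cons R d w)]
    · simp
  | single x r =>
    rw [boundary, Finsupp.linearCombination_single]
    by_cases hx : Fin.tail x = w
    · subst hx
      have : ∑ᶠ v, Finsupp.single x r (Fin.cons v (Fin.tail x)) = r := by
        rw [finsum_eq_single _ (x 0)]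
        · simp
        · intro v hv
          rw [Finsupp.single_apply, if_neg]
          intro h
          exact hv (by rw [h]; simp)
      rw [this]
      by_cases h : IsOrderedSimplex K (Fin.tail x) <;> simp [h]
    · have : ∑ᶠ v, Finsupp.single x r (Fin.cons v w) = 0 := by
        refine finsum_eq_zero_of_forall_eq_zero fun v => ?_
        rw [Finsupp.single_apply, if_neg]
        rintro rfl
        exact hx (by simp)
      rw [this]
      by_cases h : IsOrderedSimplex K (Fin.tail x) <;> simp [h, hx]

variable {K R}

theorem not_isOrderedSimplex_zero (x : Fin 0 → V) : ¬ IsOrderedSimplex K x := by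
  classical
  intro h
  simpa using (K.isRelLowerSet_faces h.2).1

theorem IsOrderedSimplex.of_range_subset {k l : ℕ} {x : Fin k → V} {y : Fin l → V}
    (hy : IsOrderedSimplex K y) (hk : k ≠ 0) (hx : Function.Injective x)
    (h : Set.range x ⊆ Set.range y) : IsOrderedSimplex K x := by
  classical
  have : NeZero k := ⟨hk⟩
  refine ⟨hx, (K.isRelLowerSet_faces hy.2).2 ?_ ⟨x 0, by simp⟩⟩
  intro v hv
  simpa using h (by simpa using hv)

theorem IsOrderedSimplex.tail {k : ℕ} {v : V} {w : Fin (k + 1) → V}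
    (h : IsOrderedSimplex K (Fin.cons v w : Fin (k + 2) → V)) : IsOrderedSimplex K w :=
  h.of_range_subset (by simp) (Fin.cons_injective_iff.1 h.1).2 (by
    rw [Fin.range_cons]; exact Set.subset_insert _ _)

theorem chains_isAlternating {k : ℕ} {c : (Fin k → V) →₀ R} (hc : c ∈ chains K R k) :
    IsAlternating c := hc.2

theorem isOrderedSimplex_of_mem_chains {k : ℕ} {c : (Fin k → V) →₀ R} (hc : c ∈ chains K R k)
    {x : Fin k → V} (hx : c x ≠ 0) : IsOrderedSimplex K x := by
  by_contra h
  exact hx (hc.1 x h)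

theorem chains_zero_eq_bot : chains K R 0 = ⊥ := by
  rw [eq_bot_iff]
  intro c hc
  exact Finsupp.ext fun x => hc.1 x (not_isOrderedSimplex_zero x)

theorem boundary_apply_of_mem {k : ℕ} {c : (Fin (k + 2) → V) →₀ R}
    (hc : c ∈ chains K R (k + 2)) (w : Fin (k + 1) → V) :
    boundary K R (k + 1) c w = ∑ᶠ v, c (Fin.cons v w) := by
  rw [boundary_apply]
  split_ifs with h
  · rfl
  · refine (finsum_eq_zero_of_forall_eq_zero fun v => ?_).symm
    by_contra hv
    exact h (isOrderedSimplex_of_mem_chains hc hv).tail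

theorem boundary_mem_chains {k : ℕ} {c : (Fin (k + 1) → V) →₀ R}
    (hc : c ∈ chains K R (k + 1)) : boundary K R k c ∈ chains K R k := by
  cases k with
  | zero =>
    have : boundary K R 0 c = 0 := by
      refine Finsupp.ext fun w => ?_
      rw [boundary_apply, if_neg (not_isOrderedSimplex_zero w)]
      rfl
    rw [this]
    exact zero_mem _
  | succ k =>
    refine ⟨fun w hw => ?_, fun w π => ?_⟩
    · change boundary K R (k + 1) c w = 0
      rw [boundary_apply, if_neg hw]
    · change boundary K R (k + 1) c _ = _ • boundary K R (k + 1) c w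
      rw [boundary_apply_of_mem hc, boundary_apply_of_mem hc,
        smul_finsum' _ (finite_support_cons R c w)]
      exact finsum_congr fun v => (chains_isAlternating hc).cons v w π

theorem boundary_boundary {k : ℕ} {c : (Fin (k + 2) → V) →₀ R} (hc : c ∈ chains K R (k + 2)) :
    boundary K R k (boundary K R (k + 1) c) = 0 := by
  classical
  ext w
  rw [boundary_apply]
  split_ifs with hw
  swap; · rfl
  simp only [boundary_apply_of_mem hc]
  -- `S` contains every vertex that occurs in `c`, so the iterated finite-support sum becomes a sum
  -- over `S × S`, where exchanging the two vertices cancels terms in pairs.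
  let S : Finset V := c.support.biUnion fun x => Finset.univ.image x
  have hS : ∀ u v, c (Fin.cons v (Fin.cons u w : Fin (k + 1) → V)) ≠ 0 → u ∈ S ∧ v ∈ S := by
    intro u v h
    simp only [S, Finset.mem_biUnion, Finset.mem_image, Finset.mem_univ, true_and]
    exact ⟨⟨_, Finsupp.mem_support_iff.2 h, 1, rfl⟩, ⟨_, Finsupp.mem_support_iff.2 h, 0, rfl⟩⟩
  have h1 : ∀ u, ∑ᶠ v, c (Fin.cons v (Fin.cons u w : Fin (k + 1) → V)) =
      ∑ v ∈ S, c (Fin.cons v (Fin.cons u w : Fin (k + 1) → V)) := fun u =>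
    finsum_eq_sum_of_support_subset _ fun v hv => (hS u v hv).2
  simp only [h1]
  rw [finsum_eq_sum_of_support_subset (s := S), ← Finset.sum_product']
  · refine Finset.sum_involution (fun p _ => (p.2, p.1)) ?_ ?_ ?_ ?_
    · rintro ⟨u, v⟩ _
      simp only
      rw [(chains_isAlternating hc).cons_cons u v]
      exact add_neg_cancel _
    -- A pair fixed by the exchange has a repeated vertex, on which chains vanish; the sign alone
    -- would not suffice in characteristic two.
    · rintro ⟨u, v⟩ _ h h'
      simp only [Prod.mk.injEq] at h'
      obtain ⟨rfl, -⟩ := h'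
      have := (isOrderedSimplex_of_mem_chains hc h).1
      exact absurd (this (a₁ := 0) (a₂ := 1) rfl) (by simp)
    · rintro ⟨u, v⟩ h
      simpa [and_comm] using h
    · rintro ⟨u, v⟩ _
      rfl
  · intro u hu
    obtain ⟨v, -, hv⟩ := Finset.exists_ne_zero_of_sum_ne_zero hu
    exact (hS u v hv).1

/-! ### Restricting chains to stars -/

variable (R)

open Classical in
/-- The part of a chain supported on the simplices having all entries of `x` as vertices. -/
def starPart {a b : ℕ} (x : Fin a → V) : ((Fin b → V) →₀ R) →ₗ[R] ((Fin b → V) →₀ R) where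
  toFun c := c.filter fun y => Set.range x ⊆ Set.range y
  map_add' _ _ := Finsupp.filter_add
  map_smul' _ _ := Finsupp.filter_smul

variable {R}

open Classical in
theorem starPart_apply {a b : ℕ} (x : Fin a → V) (c : (Fin b → V) →₀ R) (y : Fin b → V) :
    starPart R x c y = if Set.range x ⊆ Set.range y then c y else 0 := rfl

theorem starPart_apply_of_subset {a b : ℕ} {x : Fin a → V} {y : Fin b → V}
    (h : Set.range x ⊆ Set.range y) (c : (Fin b → V) →₀ R) : starPart R x c y = c y := by
  rw [starPart_apply, if_pos h]

theorem starPart_apply_of_not_subset {a b : ℕ} {x : Fin a → V} {y : Fin b → V}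
    (h : ¬ Set.range x ⊆ Set.range y) (c : (Fin b → V) →₀ R) : starPart R x c y = 0 := by
  rw [starPart_apply, if_neg h]

theorem range_subset_of_starPart_ne_zero {a b : ℕ} {x : Fin a → V} {c : (Fin b → V) →₀ R}
    {y : Fin b → V} (h : starPart R x c y ≠ 0) : Set.range x ⊆ Set.range y := by
  by_contra h'
  exact h (starPart_apply_of_not_subset h' c)

theorem starPart_congr {a a' b : ℕ} {x : Fin a → V} {x' : Fin a' → V}
    (h : Set.range x = Set.range x') (c : (Fin b → V) →₀ R) : starPart R x c = starPart R x' c := by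
  ext y
  by_cases hy : Set.range x ⊆ Set.range y
  · rw [starPart_apply_of_subset hy, starPart_apply_of_subset (h ▸ hy)]
  · rw [starPart_apply_of_not_subset hy, starPart_apply_of_not_subset (h ▸ hy)]

theorem starPart_eq_self {a b : ℕ} {x : Fin a → V} {c : (Fin b → V) →₀ R}
    (h : ∀ y, c y ≠ 0 → Set.range x ⊆ Set.range y) : starPart R x c = c := by
  ext y
  rw [starPart_apply]
  split_ifs with hy
  · rfl
  · by_contra h'
    exact hy (h y (Ne.symm h'))

theorem starPart_starPart {a a' b : ℕ} {x : Fin a → V} {x' : Fin a' → V}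
    (h : Set.range x ⊆ Set.range x') (c : (Fin b → V) →₀ R) :
    starPart R x' (starPart R x c) = starPart R x' c := by
  ext y
  simp only [starPart_apply]
  split_ifs with h1 h2
  · rfl
  · exact absurd (h.trans h1) h2
  · rfl

theorem starPart_mem_chains {a b : ℕ} (x : Fin a → V) {c : (Fin b → V) →₀ R}
    (hc : c ∈ chains K R b) : starPart R x c ∈ chains K R b := by
  refine ⟨fun y hy => ?_, fun y π => ?_⟩
  · have : c y = 0 := hc.1 y hy
    change starPart R x c y = 0
    rw [starPart_apply, this, ite_self]
  · change starPart R x c (y ∘ π) = _ • starPart R x c y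
    have e : Set.range (y ∘ π) = Set.range y := π.surjective.range_comp y
    rw [starPart_apply, starPart_apply, e, chains_isAlternating hc y π, smul_ite, smul_zero]

/-- A face containing `x'` comes only from simplices containing `x'`, hence `x`. So the terms
removed by the inner restriction do not matter: the star of `x` carries the quotient complex of
chains modulo simplices not containing `x`. -/
theorem starPart_boundary_starPart {a a' b : ℕ} {x : Fin a → V} {x' : Fin a' → V}
    (h : Set.range x ⊆ Set.range x') (c : (Fin (b + 1) → V) →₀ R) :
    starPart R x' (boundary K R b (starPart R x c)) = starPart R x' (boundary K R b c) := by
  ext w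
  by_cases hw : Set.range x' ⊆ Set.range w
  · rw [starPart_apply_of_subset hw, starPart_apply_of_subset hw, boundary_apply, boundary_apply]
    congr 1
    refine finsum_congr fun v => starPart_apply_of_subset ?_ c
    rw [Fin.range_cons]
    exact (h.trans hw).trans (Set.subset_insert _ _)
  · rw [starPart_apply_of_not_subset hw, starPart_apply_of_not_subset hw]

end Stars

/-! ### The double complex of flags -/

section DoubleComplex

variable {V : Type u} (K : PreAbstractSimplicialComplex V) (R : Type v) [CommRing R]

/-- Families of functions of `b`-tuples, indexed by `a`-tuples. -/
abbrev FlagFunctions (V : Type u) (R : Type v) [CommRing R] (a b : ℕ) : Type (max u v) :=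
  (Fin a → V) → ((Fin b → V) →₀ R)

/-- Finitely supported functions of pairs of a simplex with `b` vertices and a face of it with `a`
vertices, alternating in both. The empty face, with `a = 0`, is allowed. -/
def flagChains (a b : ℕ) : Submodule R (FlagFunctions V R a b) where
  carrier := {F | (∀ x, F x ∈ chains K R b) ∧
    (∀ x y, F x y ≠ 0 → Function.Injective x ∧ Set.range x ⊆ Set.range y) ∧
    IsAlternating F ∧ (Function.support F).Finite}
  zero_mem' := ⟨fun _ => zero_mem _, fun x y h => absurd rfl h, fun _ _ => by simp, by simp⟩
  add_mem' := by
    rintro F G ⟨h1, h2, h3, h4⟩ ⟨h1', h2', h3', h4'⟩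
    refine ⟨fun x => add_mem (h1 x) (h1' x), fun x y h => ?_, fun x π => ?_,
      (h4.union h4').subset (Function.support_add _ _)⟩
    · by_cases hF : F x y = 0
      · exact h2' x y fun hG => h (by simp [hF, hG])
      · exact h2 x y hF
    · simp only [Pi.add_apply, h3 x π, h3' x π, smul_add]
  smul_mem' := by
    rintro r F ⟨h1, h2, h3, h4⟩
    refine ⟨fun x => Submodule.smul_mem _ r (h1 x), fun x y h => h2 x y fun hF => h (by simp [hF]),
      fun x π => ?_, h4.subset (Function.support_const_smul_subset r _)⟩
    simp only [Pi.smul_apply, h3 x π, smul_comm r]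

/-- The differential in the direction of the faces, given by the coboundary. -/
def faceDiff (V : Type u) (R : Type v) [CommRing R] (a b : ℕ) :
    FlagFunctions V R a b →ₗ[R] FlagFunctions V R (a + 1) b where
  toFun F z := starPart R z (faceSum F z)
  map_add' F G := by
    ext1 z
    simp only [faceSum, Pi.add_apply, smul_add, Finset.sum_add_distrib, map_add]
  map_smul' r F := by
    ext1 z
    simp only [faceSum, Pi.smul_apply, smul_comm _ r, ← Finset.smul_sum, map_smul,
      RingHom.id_apply]

/-- The differential in the direction of the simplices, given by the boundary. -/
def simplexDiff (a b : ℕ) : FlagFunctions V R a (b + 1) →ₗ[R] FlagFunctions V R a b where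
  toFun F x := starPart R x (boundary K R b (F x))
  map_add' F G := by
    ext1 x
    simp only [Pi.add_apply, map_add]
  map_smul' r F := by
    ext1 x
    simp only [Pi.smul_apply, map_smul, RingHom.id_apply]

variable {K R}

theorem faceDiff_apply {a b : ℕ} (F : FlagFunctions V R a b) (z : Fin (a + 1) → V) :
    faceDiff V R a b F z = starPart R z (faceSum F z) := rfl

theorem simplexDiff_apply {a b : ℕ} (F : FlagFunctions V R a (b + 1)) (x : Fin a → V) :
    simplexDiff K R a b F x = starPart R x (boundary K R b (F x)) := rfl

theorem flagChains_eq_zero {a b : ℕ} {F : FlagFunctions V R a b} (hF : F ∈ flagChains K R a b)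
    {x : Fin a → V} (hx : ¬ Function.Injective x) : F x = 0 := by
  ext y
  by_contra h
  exact hx (hF.2.1 x y h).1

theorem flagChains_zero_right (a : ℕ) : flagChains K R a 0 = ⊥ := by
  rw [eq_bot_iff]
  intro F hF
  ext1 x
  have := hF.1 x
  rw [chains_zero_eq_bot] at this
  exact this

theorem finite_setOf_range_subset {a b : ℕ} (y : Fin b → V) :
    {z : Fin a → V | Set.range z ⊆ Set.range y}.Finite := by
  have := Set.Finite.pi' (ι := Fin a) (fun _ => Set.finite_range y)
  refine this.subset fun z hz i => hz ⟨i, rfl⟩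

theorem finite_biUnion_support {a b : ℕ} {F : FlagFunctions V R a b}
    (hF : (Function.support F).Finite) : {y | ∃ x, F x y ≠ 0}.Finite := by
  refine (hF.biUnion fun x _ => (F x).hasFiniteSupport).subset ?_
  rintro y ⟨x, hx⟩
  simp only [Set.mem_iUnion]
  exact ⟨x, fun h => hx (by rw [h]; rfl), hx⟩

/-- Only finitely many simplices `y` occur in `F`, and each of them has finitely many faces. -/
theorem finite_support_of_subset {a a' b : ℕ} {F : FlagFunctions V R a b}
    (hF : (Function.support F).Finite) {G : FlagFunctions V R a' b}
    (hG : ∀ z y, G z y ≠ 0 → Set.range z ⊆ Set.range y ∧ ∃ x, F x y ≠ 0) :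
    (Function.support G).Finite := by
  refine ((finite_biUnion_support hF).biUnion fun y _ =>
    finite_setOf_range_subset (a := a') y).subset fun z hz => ?_
  obtain ⟨y, hy⟩ := Finsupp.ne_iff.1 hz
  simp only [Set.mem_iUnion]
  exact ⟨y, (hG z y hy).2, (hG z y hy).1⟩

theorem faceSum_finsupp_apply {a b : ℕ} (F : FlagFunctions V R a b) (z : Fin (a + 1) → V)
    (y : Fin b → V) : faceSum F z y = faceSum (fun x => F x y) z := by
  simp [faceSum, Finsupp.finsetSum_apply]

theorem exists_of_faceSum_ne_zero {V M : Type*} [AddCommGroup M] {k : ℕ} {F : (Fin k → V) → M}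
    {z : Fin (k + 1) → V} (h : faceSum F z ≠ 0) : ∃ x, F x ≠ 0 := by
  by_contra! h'
  exact h (by simp [faceSum, h'])

theorem faceDiff_mem {a b : ℕ} {F : FlagFunctions V R a b} (hF : F ∈ flagChains K R a b) :
    faceDiff V R a b F ∈ flagChains K R (a + 1) b := by
  refine ⟨fun z => starPart_mem_chains z (Submodule.sum_mem _ fun j _ => ?_),
    fun z y h => ⟨?_, range_subset_of_starPart_ne_zero h⟩, fun z π => ?_,
    finite_support_of_subset hF.2.2.2 fun z y h => ⟨range_subset_of_starPart_ne_zero h, ?_⟩⟩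
  · exact zsmul_mem (hF.1 _) _
  · by_contra hz
    refine h ?_
    rw [faceDiff_apply, faceSum_eq_zero_of_not_injective hF.2.2.1
      (fun x hx => flagChains_eq_zero hF hx) z hz, map_zero]
    rfl
  · rw [faceDiff_apply, faceDiff_apply, starPart_congr (π.surjective.range_comp z),
      hF.2.2.1.faceSum z π, map_zsmul]
  · rw [faceDiff_apply, starPart_apply_of_subset (range_subset_of_starPart_ne_zero h),
      faceSum_finsupp_apply] at h
    exact exists_of_faceSum_ne_zero h

theorem simplexDiff_mem {a b : ℕ} {F : FlagFunctions V R a (b + 1)}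
    (hF : F ∈ flagChains K R a (b + 1)) : simplexDiff K R a b F ∈ flagChains K R a b := by
  refine ⟨fun x => starPart_mem_chains x (boundary_mem_chains (hF.1 x)),
    fun x y h => ⟨?_, range_subset_of_starPart_ne_zero h⟩, fun x π => ?_,
    hF.2.2.2.subset fun x hx h => hx ?_⟩
  · by_contra hx
    refine h ?_
    rw [simplexDiff_apply, flagChains_eq_zero hF hx, map_zero, map_zero]
    rfl
  · rw [simplexDiff_apply, simplexDiff_apply, starPart_congr (π.surjective.range_comp x),
      hF.2.2.1 x π, map_zsmul, map_zsmul]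
  · rw [simplexDiff_apply, h, map_zero, map_zero]

theorem range_comp_subset {α β : Type*} (z : β → V) (f : α → β) :
    Set.range (z ∘ f) ⊆ Set.range z := by
  rintro _ ⟨i, rfl⟩
  exact ⟨f i, rfl⟩

/-- Restriction to the star of `z` absorbs the earlier restrictions to the stars of its faces,
leaving the plain alternating face sum, whose square is zero. -/
theorem faceDiff_faceDiff {a b : ℕ} (F : FlagFunctions V R a b) :
    faceDiff V R (a + 1) b (faceDiff V R a b F) = 0 := by
  ext1 z
  have h : starPart R z (faceSum (faceDiff V R a b F) z) =
      starPart R z (faceSum (faceSum F) z) := by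
    simp only [faceSum, map_sum, map_zsmul]
    refine Finset.sum_congr rfl fun j _ => ?_
    rw [faceDiff_apply, starPart_starPart (range_comp_subset z _)]
    simp only [faceSum, map_sum, map_zsmul]
  rw [faceDiff_apply, h, faceSum_faceSum, map_zero]
  rfl

theorem simplexDiff_simplexDiff {a b : ℕ} {F : FlagFunctions V R a (b + 2)}
    (hF : F ∈ flagChains K R a (b + 2)) :
    simplexDiff K R a b (simplexDiff K R a (b + 1) F) = 0 := by
  ext1 x
  rw [simplexDiff_apply, simplexDiff_apply, starPart_boundary_starPart subset_rfl,
    boundary_boundary (hF.1 x), map_zero]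
  rfl

/-- The two differentials act on different variables, so they commute once all restrictions are
absorbed into the one to the star of `z`. No sign is inserted: the squares of the double complex
commute. -/
theorem faceDiff_simplexDiff {a b : ℕ} (F : FlagFunctions V R a (b + 1)) :
    faceDiff V R a b (simplexDiff K R a b F) =
      simplexDiff K R (a + 1) b (faceDiff V R a (b + 1) F) := by
  ext1 z
  rw [faceDiff_apply, simplexDiff_apply, faceDiff_apply, starPart_boundary_starPart subset_rfl]
  simp only [faceSum, map_sum, map_zsmul]
  refine Finset.sum_congr rfl fun j _ => ?_
  rw [simplexDiff_apply, starPart_starPart (range_comp_subset z _)]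

/-! ### Exactness of the rows -/

/-- A vertex of each simplex. -/
def someVertex {b : ℕ} (y : Fin (b + 1) → V) : V := (Set.range_nonempty y).some

theorem someVertex_mem {b : ℕ} (y : Fin (b + 1) → V) : someVertex y ∈ Set.range y :=
  (Set.range_nonempty y).some_mem

/-- The choice depends only on the set of vertices, which keeps the contraction built from it
alternating in `y`. -/
theorem someVertex_comp {b : ℕ} (y : Fin (b + 1) → V) (π : Equiv.Perm (Fin (b + 1))) :
    someVertex (y ∘ π) = someVertex y := by
  have : ∀ (S T : Set V) (hS : S.Nonempty) (hT : T.Nonempty), S = T → hS.some = hT.some := by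
    rintro S T hS hT rfl
    rfl
  exact this _ _ _ _ (π.surjective.range_comp y)

theorem range_cons_subset_iff {a : ℕ} {v : V} {x : Fin a → V} {S : Set V} (hv : v ∈ S) :
    Set.range (Fin.cons v x : Fin (a + 1) → V) ⊆ S ↔ Set.range x ⊆ S := by
  rw [Fin.range_cons, Set.insert_subset_iff]
  exact and_iff_right hv

/-- The rows of the double complex are exact. -/
theorem exists_faceDiff_eq {a b : ℕ} {F : FlagFunctions V R (a + 1) b}
    (hF : F ∈ flagChains K R (a + 1) b) (hd : faceDiff V R (a + 1) b F = 0) :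
    ∃ G ∈ flagChains K R a b, faceDiff V R a b G = F := by
  cases b with
  | zero =>
    rw [flagChains_zero_right] at hF
    have : F = 0 := hF
    exact ⟨0, zero_mem _, by rw [this, map_zero]⟩
  | succ b =>
    -- The contraction of the full simplex on `y` to its chosen vertex, done for every `y`
    -- separately. It need not be equivariant, since only existence of a preimage is used.
    let G : FlagFunctions V R a (b + 1) := fun x =>
      Finsupp.ofSupportFinite (fun y => F (Fin.cons (someVertex y) x) y)
        ((finite_biUnion_support hF.2.2.2).subset fun y hy => ⟨_, hy⟩)
    have hG : ∀ x y, G x y = F (Fin.cons (someVertex y) x) y := fun x y => rfl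
    refine ⟨G, ⟨fun x => ⟨fun y hy => ?_, fun y π => ?_⟩, fun x y h => ?_, fun x π => ?_,
      finite_support_of_subset hF.2.2.2 fun z y h => ?_⟩, ?_⟩
    · exact (hF.1 _).1 y hy
    · change G x (y ∘ π) = _ • G x y
      rw [hG, hG, someVertex_comp]
      exact (hF.1 _).2 y π
    · rw [hG] at h
      obtain ⟨h1, h2⟩ := hF.2.1 _ _ h
      exact ⟨(Fin.cons_injective_iff.1 h1).2, (range_cons_subset_iff (someVertex_mem y)).1 h2⟩
    · ext y
      have := congrArg (fun c => c y) (hF.2.2.1.cons (someVertex y) x π)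
      exact this
    · rw [hG] at h
      exact ⟨(range_cons_subset_iff (someVertex_mem y)).1 (hF.2.1 _ _ h).2, _, h⟩
    · ext z y
      by_cases hz : Set.range z ⊆ Set.range y
      -- Expanding the cocycle condition at the cone over `z` gives `F z y` minus the face sum of
      -- `G`.
      · have h := congrArg (fun H => H (Fin.cons (someVertex y) z) y) hd
        simp only [Pi.zero_apply, Finsupp.zero_apply] at h
        rw [faceDiff_apply, starPart_apply_of_subset
          ((range_cons_subset_iff (someVertex_mem y)).2 hz), faceSum_finsupp_apply, faceSum_cons,
          sub_eq_zero] at h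
        rw [faceDiff_apply, starPart_apply_of_subset hz, faceSum_finsupp_apply, h]
        rfl
      · rw [faceDiff_apply, starPart_apply_of_not_subset hz]
        by_contra h
        exact hz (hF.2.1 z y (Ne.symm h)).2

theorem eq_zero_of_faceDiff_eq_zero {b : ℕ} {F : FlagFunctions V R 0 b}
    (hF : F ∈ flagChains K R 0 b) (hd : faceDiff V R 0 b F = 0) : F = 0 := by
  cases b with
  | zero =>
    rw [flagChains_zero_right] at hF
    exact hF
  | succ b =>
    ext x y
    -- The differential from the empty face is the augmentation; evaluating it at any vertex of `y`
    -- recovers the value of `F`.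
    have h := congrArg (fun H => H (fun _ => y 0) y) hd
    simp only [Pi.zero_apply, Finsupp.zero_apply] at h
    rw [faceDiff_apply, starPart_apply_of_subset (by rintro _ ⟨i, rfl⟩; exact ⟨0, rfl⟩),
      faceSum_finsupp_apply] at h
    simp only [faceSum] at h
    simp at h
    rw [Subsingleton.elim x]
    exact h

end DoubleComplex

/-! ### Chains in a star and chains in the link -/

section Links

variable {V : Type u}

open Classical in
/-- The vertices of an ordered simplex. -/
def vertexSet {k : ℕ} (x : Fin k → V) : Finset V := Finset.univ.image x

theorem coe_vertexSet {k : ℕ} (x : Fin k → V) : (vertexSet x : Set V) = Set.range x := by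
  simp [vertexSet]

theorem card_vertexSet {k : ℕ} {x : Fin k → V} (hx : Function.Injective x) :
    (vertexSet x).card = k := by
  classical
  rw [vertexSet, Finset.card_image_of_injective _ hx]
  simp

/-- The tuple `z` followed by the tuple `x`. -/
def joinTuple {k a b : ℕ} (h : k + a = b) (z : Fin k → V) (x : Fin a → V) : Fin b → V :=
  Fin.append z x ∘ Fin.cast h.symm

theorem joinTuple_cons {k a b : ℕ} (h : k + a = b) (h' : k + 1 + a = b + 1) (v : V)
    (z : Fin k → V) (x : Fin a → V) :
    joinTuple h' (Fin.cons v z : Fin (k + 1) → V) x = Fin.cons v (joinTuple h z x) := by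
  subst h
  simp only [joinTuple, Fin.append_cons]
  rfl

theorem joinTuple_zero {a : ℕ} (h : 0 + a = a) (z : Fin 0 → V) (x : Fin a → V) :
    joinTuple h z x = x := by
  rw [joinTuple, Fin.append_left_nil _ _ rfl]
  rfl

theorem joinTuple_one {a : ℕ} (h : 1 + a = a + 1) (z : Fin 1 → V) (x : Fin a → V) :
    joinTuple h z x = Fin.cons (z 0) x := by
  have : z = Fin.cons (z 0) (Fin.elim0 : Fin 0 → V) := by
    ext i
    rw [Subsingleton.elim i 0]
    rfl
  rw [this, joinTuple_cons (by omega), joinTuple_zero]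
  rfl

theorem range_joinTuple {k a b : ℕ} (h : k + a = b) (z : Fin k → V) (x : Fin a → V) :
    Set.range (joinTuple h z x) = Set.range z ∪ Set.range x := by
  subst h
  rw [joinTuple]
  ext v
  constructor
  · rintro ⟨i, rfl⟩
    simp only [Function.comp, Fin.cast_refl]
    refine Fin.addCases (fun i => ?_) (fun i => ?_) i
    · exact Or.inl ⟨i, by simp⟩
    · exact Or.inr ⟨i, by simp⟩
  · rintro (⟨i, rfl⟩ | ⟨i, rfl⟩)
    · exact ⟨Fin.castAdd a i, by simp⟩
    · exact ⟨Fin.natAdd k i, by simp⟩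

theorem joinTuple_injective_iff {k a b : ℕ} (h : k + a = b) {z : Fin k → V} {x : Fin a → V} :
    Function.Injective (joinTuple h z x) ↔
      Function.Injective z ∧ Function.Injective x ∧ Disjoint (Set.range z) (Set.range x) := by
  subst h
  rw [show joinTuple rfl z x = Fin.append z x from rfl, Fin.append_injective_iff,
    Set.disjoint_iff_forall_ne]
  simp

theorem joinTuple_left_injective {k a b : ℕ} (h : k + a = b) (x : Fin a → V) :
    Function.Injective fun z : Fin k → V => joinTuple h z x := by
  subst h
  intro z z' hz
  ext i
  simpa [joinTuple] using congrFun hz (Fin.castAdd a i)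

theorem exists_perm_joinTuple {k a b : ℕ} (h : k + a = b) (π : Equiv.Perm (Fin k)) :
    ∃ ρ : Equiv.Perm (Fin b), Equiv.Perm.sign ρ = Equiv.Perm.sign π ∧
      ∀ (z : Fin k → V) (x : Fin a → V), joinTuple h (z ∘ π) x = joinTuple h z x ∘ ρ := by
  subst h
  refine ⟨finSumFinEquiv.permCongr (Equiv.Perm.sumCongr π 1), by simp, fun z x => ?_⟩
  ext i
  refine Fin.addCases (fun i => ?_) (fun i => ?_) i <;> simp [joinTuple, Equiv.permCongr_apply]

theorem exists_comp_eq_joinTuple {k a b : ℕ} (h : k + a = b) {x : Fin a → V} {y : Fin b → V}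
    (hx : Function.Injective x) (hy : Function.Injective y) (hxy : Set.range x ⊆ Set.range y) :
    ∃ (z : Fin k → V) (π : Equiv.Perm (Fin b)), joinTuple h z x = y ∘ π := by
  classical
  have hs : vertexSet x ⊆ vertexSet y := by
    rwa [← Finset.coe_subset, coe_vertexSet, coe_vertexSet]
  have hc : (vertexSet y \ vertexSet x).card = k := by
    rw [Finset.card_sdiff_of_subset hs, card_vertexSet hx, card_vertexSet hy]
    omega
  let e := (Finset.equivFinOfCardEq hc).symm
  let z : Fin k → V := fun i => (e i).1
  have hz : Set.range z = Set.range y \ Set.range x := by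
    rw [← coe_vertexSet x, ← coe_vertexSet y, ← Finset.coe_sdiff]
    ext v
    constructor
    · rintro ⟨i, rfl⟩
      exact (e i).2
    · intro hv
      exact ⟨e.symm ⟨v, hv⟩, by simp [z]⟩
  refine ⟨z, exists_perm_of_range_eq hy ((joinTuple_injective_iff h).2 ⟨?_, hx, ?_⟩) ?_⟩
  · exact Subtype.val_injective.comp e.injective
  · rw [hz]
    exact Set.disjoint_sdiff_left
  · rw [range_joinTuple, hz, Set.sdiff_union_of_subset hxy]

variable {K : PreAbstractSimplicialComplex V} {R : Type v} [CommRing R]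

theorem IsOrderedSimplex.comp {k : ℕ} {x : Fin k → V} (hx : IsOrderedSimplex K x)
    (π : Equiv.Perm (Fin k)) : IsOrderedSimplex K (x ∘ π) := by
  classical
  cases k with
  | zero => exact absurd hx (not_isOrderedSimplex_zero x)
  | succ k =>
    exact hx.of_range_subset (by simp) (hx.1.comp π.injective) (range_comp_subset x π)

/-- The case `k = 0` is excluded because the empty tuple is no simplex of the link, while its join
with `x` is `x` itself. This is the difference between ordinary and augmented chains. -/
theorem isOrderedSimplex_link_iff {k a b : ℕ} (h : k + a = b) (hk : k ≠ 0) {z : Fin k → V}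
    {x : Fin a → V} (hx : Function.Injective x) :
    IsOrderedSimplex (link K (vertexSet x)) z ↔ IsOrderedSimplex K (joinTuple h z x) := by
  classical
  have e : Finset.univ.image (joinTuple h z x) = Finset.univ.image z ∪ vertexSet x := by
    rw [← Finset.coe_inj, Finset.coe_union, coe_vertexSet]
    simp [range_joinTuple]
  have hz : ∀ z : Fin k → V, Finset.univ.image z = vertexSet z := fun z => by
    rw [← Finset.coe_inj, coe_vertexSet]
    simp
  constructor
  · rintro ⟨h1, -, h3, h4⟩
    refine ⟨(joinTuple_injective_iff h).2 ⟨h1, hx, ?_⟩, ?_⟩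
    · rw [← Finset.disjoint_coe, coe_vertexSet] at h3
      simpa using h3
    · rw [e]
      convert h4
  · intro hj
    obtain ⟨h1, -, h3⟩ := (joinTuple_injective_iff h).1 hj.1
    refine ⟨h1, (hj.of_range_subset hk h1 ?_).2, ?_, ?_⟩
    · rw [range_joinTuple]
      exact Set.subset_union_left
    · rw [← Finset.disjoint_coe, coe_vertexSet]
      simpa using h3
    · have := hj.2
      rw [e] at this
      convert this

/-- The chains on the simplices having all entries of `x` as vertices. -/
def starChains (K : PreAbstractSimplicialComplex V) (R : Type v) [CommRing R] {a : ℕ}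
    (x : Fin a → V) (b : ℕ) : Submodule R ((Fin b → V) →₀ R) where
  carrier := {c | c ∈ chains K R b ∧ ∀ y, c y ≠ 0 → Set.range x ⊆ Set.range y}
  zero_mem' := ⟨zero_mem _, fun y h => absurd rfl h⟩
  add_mem' := by
    rintro c d ⟨hc, hc'⟩ ⟨hd, hd'⟩
    refine ⟨add_mem hc hd, fun y h => ?_⟩
    by_cases h0 : c y = 0
    · exact hd' y fun h1 => h (by simp [h0, h1])
    · exact hc' y h0
  smul_mem' := by
    rintro r c ⟨hc, hc'⟩
    exact ⟨Submodule.smul_mem _ r hc, fun y h => hc' y fun h0 => h (by simp [h0])⟩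

theorem starPart_mem_starChains {a b : ℕ} (x : Fin a → V) {c : (Fin b → V) →₀ R}
    (hc : c ∈ chains K R b) : starPart R x c ∈ starChains K R x b :=
  ⟨starPart_mem_chains x hc, fun _ h => range_subset_of_starPart_ne_zero h⟩

variable (R)

/-- The chain on the link of `x` obtained from a chain on the star of `x`. -/
def linkPart {k a b : ℕ} (h : k + a = b) (x : Fin a → V) :
    ((Fin b → V) →₀ R) →ₗ[R] ((Fin k → V) →₀ R) :=
  Finsupp.lcomapDomain (fun z => joinTuple h z x) (joinTuple_left_injective h x)

variable {R}

theorem linkPart_apply {k a b : ℕ} (h : k + a = b) (x : Fin a → V) (c : (Fin b → V) →₀ R)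
    (z : Fin k → V) : linkPart R h x c z = c (joinTuple h z x) := rfl

theorem linkPart_starPart {k a b : ℕ} (h : k + a = b) (x : Fin a → V) (c : (Fin b → V) →₀ R) :
    linkPart R h x (starPart R x c) = linkPart R h x c := by
  ext z
  rw [linkPart_apply, linkPart_apply, starPart_apply_of_subset]
  rw [range_joinTuple]
  exact Set.subset_union_right

theorem linkPart_mem_chains {k a b : ℕ} (h : k + a = b) (hk : k ≠ 0) {x : Fin a → V}
    (hx : Function.Injective x) {c : (Fin b → V) →₀ R} (hc : c ∈ chains K R b) :
    linkPart R h x c ∈ chains (link K (vertexSet x)) R k := by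
  refine ⟨fun z hz => ?_, fun z π => ?_⟩
  · rw [isOrderedSimplex_link_iff h hk hx] at hz
    exact hc.1 _ hz
  · obtain ⟨ρ, hρ, hρ'⟩ := exists_perm_joinTuple (V := V) h π
    change c (joinTuple h (z ∘ π) x) = _ • c (joinTuple h z x)
    rw [hρ', ← hρ]
    exact hc.2 _ ρ

/-- The boundary sums over a new first entry, and joins put the link vertices first, so the two
boundaries match without a sign. -/
theorem linkPart_boundary {k a b : ℕ} (h : k + a = b) (h' : k + 1 + a = b + 1) (hk : k ≠ 0)
    {x : Fin a → V} (hx : Function.Injective x) (c : (Fin (b + 1) → V) →₀ R) :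
    linkPart R h x (boundary K R b c) =
      boundary (link K (vertexSet x)) R k (linkPart R h' x c) := by
  ext z
  rw [linkPart_apply, boundary_apply, boundary_apply]
  have hz := isOrderedSimplex_link_iff (K := K) h hk hx (z := z)
  simp only [linkPart_apply, joinTuple_cons h h']
  by_cases h0 : IsOrderedSimplex K (joinTuple h z x)
  · rw [if_pos h0, if_pos (hz.2 h0)]
  · rw [if_neg h0, if_neg fun h1 => h0 (hz.1 h1)]

/-- Every simplex of the star can be reordered so that it ends in `x`, so an alternating chain is
determined by its values there. -/
theorem eq_zero_of_linkPart_eq_zero {k a b : ℕ} (h : k + a = b) {x : Fin a → V}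
    (hx : Function.Injective x) {c : (Fin b → V) →₀ R} (hc : c ∈ starChains K R x b)
    (h0 : linkPart R h x c = 0) : c = 0 := by
  ext y
  by_contra hy
  obtain ⟨z, π, hz⟩ := exists_comp_eq_joinTuple h hx
    (isOrderedSimplex_of_mem_chains hc.1 hy).1 (hc.2 y hy)
  have h1 : c (joinTuple h z x) = 0 := congrArg (fun c => c z) h0
  rw [hz, chains_isAlternating hc.1] at h1
  rcases Int.units_eq_one_or (Equiv.Perm.sign π) with e | e <;> exact hy (by simpa [e] using h1)

theorem eq_of_linkPart_eq {k a b : ℕ} (h : k + a = b) {x : Fin a → V}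
    (hx : Function.Injective x) {c d : (Fin b → V) →₀ R} (hc : c ∈ starChains K R x b)
    (hd : d ∈ starChains K R x b) (hcd : linkPart R h x c = linkPart R h x d) : c = d :=
  sub_eq_zero.1 (eq_zero_of_linkPart_eq_zero h hx (sub_mem hc hd) (by rw [map_sub, hcd, sub_self]))

theorem exists_linkPart_eq {k a b : ℕ} (h : k + a = b) (x : Fin a → V) {g : (Fin k → V) →₀ R}
    (hg : IsAlternating g) (hg0 : ∀ z, g z ≠ 0 → IsOrderedSimplex K (joinTuple h z x)) :
    ∃ c ∈ starChains K R x b, linkPart R h x c = g := by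
  obtain ⟨c, hc, hc1, hc0⟩ := exists_isAlternating_extension
    {y | ∃ z : Fin k → V, IsOrderedSimplex K (joinTuple h z x) ∧ y = joinTuple h z x}
    (fun y => g fun i => y (Fin.cast h (Fin.castAdd a i))) (by
      have e : ∀ z : Fin k → V, (fun i => joinTuple h z x (Fin.cast h (Fin.castAdd a i))) = z :=
        fun z => by ext i; simp [joinTuple]
      rintro _ ⟨z, hz, rfl⟩ π ⟨z', hz', hπ⟩
      simp only [hπ, e]
      obtain ⟨h1, h2, h3⟩ := (joinTuple_injective_iff h).1 hz.1
      obtain ⟨h1', -, h3'⟩ := (joinTuple_injective_iff h).1 hz'.1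
      -- Two joins with the same `x` that differ by a permutation differ only in the link part, and
      -- the sign of the permutation is that of its restriction; so alternation of `g` suffices.
      have hr : Set.range z = Set.range z' := by
        have := π.surjective.range_comp (joinTuple h z x)
        rw [hπ, range_joinTuple, range_joinTuple] at this
        rw [← h3.sup_sdiff_cancel_right, ← h3'.sup_sdiff_cancel_right]
        simp only [Set.sup_eq_union, this]
      obtain ⟨ρ, rfl⟩ := exists_perm_of_range_eq h1 h1' hr
      obtain ⟨τ, hτ, hτ'⟩ := exists_perm_joinTuple (V := V) h ρ
      have : π = τ := by
        rw [hτ'] at hπ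
        exact Equiv.ext fun i => hz.1 (congrFun hπ i)
      rw [this, hτ]
      exact hg z ρ)
  have hP : ∀ y, c y ≠ 0 → ∃ (z : Fin k → V) (π : Equiv.Perm (Fin b)),
      IsOrderedSimplex K (joinTuple h z x) ∧ y ∘ π = joinTuple h z x ∧ g z ≠ 0 := by
    intro y hy
    by_contra! hne
    refine hy (hc0 y ?_)
    rintro π ⟨z, hz, hπ⟩
    have h1 := hc1 (y ∘ π) ⟨z, hz, hπ⟩
    simp only [hπ] at h1
    have e : (fun i => joinTuple h z x (Fin.cast h (Fin.castAdd a i))) = z := by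
      ext i; simp [joinTuple]
    rw [e, hne z π hz hπ, ← hπ, hc] at h1
    rcases Int.units_eq_one_or (Equiv.Perm.sign π) with e | e <;> exact hy (by simpa [e] using h1)
  have hfin : (Function.support c).Finite := by
    refine (g.hasFiniteSupport.biUnion fun z _ =>
      finite_setOf_range_subset (a := b) (joinTuple h z x)).subset fun y hy => ?_
    obtain ⟨z, π, -, h2, h3⟩ := hP y hy
    simp only [Set.mem_iUnion]
    refine ⟨z, h3, ?_⟩
    rw [Set.mem_ofPred_eq, ← h2, π.surjective.range_comp]
  refine ⟨Finsupp.ofSupportFinite c hfin, ⟨⟨fun y hy => ?_, hc⟩, fun y hy => ?_⟩, ?_⟩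
  · by_contra h0
    obtain ⟨z, π, h1, h2, -⟩ := hP y h0
    refine hy ?_
    have := h1.comp π⁻¹
    rw [← h2, Function.comp_assoc] at this
    simpa using this
  · obtain ⟨z, π, -, h2, -⟩ := hP y hy
    rw [← π.surjective.range_comp y, h2, range_joinTuple]
    exact Set.subset_union_right
  · ext z
    change c (joinTuple h z x) = g z
    by_cases hz : IsOrderedSimplex K (joinTuple h z x)
    · rw [hc1 _ ⟨z, hz, rfl⟩]
      congr 1
      ext i
      simp [joinTuple]
    · have : g z = 0 := by
        by_contra h0
        exact hz (hg0 z h0)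
      rw [this]
      by_contra h0
      obtain ⟨z', π, h1, h2, -⟩ := hP _ h0
      refine hz ?_
      have := h1.comp π⁻¹
      rw [← h2, Function.comp_assoc] at this
      simpa using this

theorem exists_linkPart_eq_of_mem_chains {k a b : ℕ} (h : k + a = b) (hk : k ≠ 0) {x : Fin a → V}
    (hx : Function.Injective x) {g : (Fin k → V) →₀ R}
    (hg : g ∈ chains (link K (vertexSet x)) R k) :
    ∃ c ∈ starChains K R x b, linkPart R h x c = g :=
  exists_linkPart_eq h x (chains_isAlternating hg) fun _ hz =>
    (isOrderedSimplex_link_iff h hk hx).1 (isOrderedSimplex_of_mem_chains hg hz)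

/-! ### The augmentation of the link -/

/-- The sum of the coefficients of a chain. -/
def augmentation (V : Type u) (R : Type v) [CommRing R] : ((Fin 1 → V) →₀ R) →ₗ[R] R :=
  Finsupp.linearCombination R fun _ => 1

/-- This supplies the bottom differential of the column, which the unaugmented chains of the link
lack. -/
theorem boundary_apply_eq_augmentation {a : ℕ} (h : 1 + a = a + 1) {x : Fin a → V}
    (hx : IsOrderedSimplex K x) (c : (Fin (a + 1) → V) →₀ R) :
    boundary K R a c x = augmentation V R (linkPart R h x c) := by
  classical
  rw [boundary_apply, if_pos hx, augmentation, Finsupp.linearCombination_apply, Finsupp.sum,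
    ← finsum_eq_sum_of_support_subset (s := (linkPart R h x c).support)]
  · refine finsum_eq_of_bijective (fun v _ => v) ⟨fun u v huv => congrFun huv 0, fun z =>
      ⟨z 0, funext fun i => by rw [Subsingleton.elim i 0]⟩⟩ fun v => ?_
    rw [linkPart_apply, joinTuple_one, smul_eq_mul, mul_one]
  · intro z hz
    simpa using hz

/-- Lifted to the star of `x`, this is the vanishing of the double boundary at `x`. -/
theorem augmentation_boundary_link {a : ℕ} {x : Fin a → V} (hx : IsOrderedSimplex K x)
    {g : (Fin 2 → V) →₀ R} (hg : g ∈ chains (link K (vertexSet x)) R 2) :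
    augmentation V R (boundary (link K (vertexSet x)) R 1 g) = 0 := by
  obtain ⟨d, hd, rfl⟩ := exists_linkPart_eq_of_mem_chains (b := a + 2) (by omega) (by simp) hx.1 hg
  rw [← linkPart_boundary (b := a + 1) (by omega) (by omega) (by simp) hx.1,
    ← boundary_apply_eq_augmentation _ hx, boundary_boundary hd.1]
  rfl

theorem single_mem_chains {z : Fin 1 → V} (hz : IsOrderedSimplex K z) (r : R) :
    Finsupp.single z r ∈ chains K R 1 := by
  classical
  refine ⟨fun y hy => ?_, fun y π => ?_⟩
  · change Finsupp.single z r y = 0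
    rw [Finsupp.single_apply, if_neg]
    rintro rfl
    exact hy hz
  · rw [Subsingleton.elim π 1]
    simp

end Links

/-! ### Complexes all of whose links have the homology of spheres -/

section SphericalLinks

variable {V : Type u} {K : PreAbstractSimplicialComplex V} {R : Type v} [CommRing R] {n : ℕ}

theorem mkQ_subquotient_eq_zero_iff {R : Type v} {M : Type*} [CommRing R] [AddCommGroup M]
    [Module R M] {Z B : Submodule R M} (z : Z) :
    (B.comap Z.subtype).mkQ z = 0 ↔ (z : M) ∈ B := by
  rw [Submodule.mkQ_apply, Submodule.Quotient.mk_eq_zero]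
  rfl

theorem exists_generator_of_subquotient_equiv {R : Type v} {M : Type*} [CommRing R]
    [AddCommGroup M] [Module R M] {Z B : Submodule R M} (e : Subquotient Z B ≃ₗ[R] R)
    (hB : B = ⊥) : ∃ g ∈ Z, ∀ z ∈ Z, ∃ r : R, z = r • g := by
  let f : Z →ₗ[R] R := e.toLinearMap.comp (B.comap Z.subtype).mkQ
  have hf : Function.Injective f := by
    rw [injective_iff_map_eq_zero]
    intro z hz
    have h := (mkQ_subquotient_eq_zero_iff z).1 (e.map_eq_zero_iff.1 hz)
    rw [hB, Submodule.mem_bot] at h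
    exact Subtype.ext h
  obtain ⟨g, hg⟩ : ∃ g, f g = 1 := (e.surjective.comp (Submodule.mkQ_surjective _)) 1
  refine ⟨g, g.2, fun z hz => ⟨f ⟨z, hz⟩, ?_⟩⟩
  have : (⟨z, hz⟩ : Z) = f ⟨z, hz⟩ • g := hf (by rw [map_smul, hg, smul_eq_mul, mul_one])
  exact congrArg Subtype.val this

/-- The conditions on a homology manifold, in terms of ordered simplices. -/
structure HasSphericalLinks (K : PreAbstractSimplicialComplex V) (R : Type v) [CommRing R]
    (n : ℕ) : Prop where
  locallyFinite : LocallyFinite K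
  link_homology : ∀ {a : ℕ} {x : Fin a → V}, IsOrderedSimplex K x → ∀ k : ℕ,
    Nonempty (Subquotient (cycles (link K (vertexSet x)) R (k + 1))
      (boundaries (link K (vertexSet x)) R (k + 1)) ≃ₗ[R]
        (Fin (sphereRank ((n : ℤ) - a) k) → R))

theorem IsHomologyManifold.hasSphericalLinks {L : AbstractSimplicialComplex V}
    (hL : IsHomologyManifold R n L) :
    HasSphericalLinks L.toPreAbstractSimplicialComplex R n := by
  classical
  refine ⟨hL.locallyFinite, fun {a x} hx k => ?_⟩
  have hs : vertexSet x ∈ L := hx.2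
  have h := hL.link_homology _ hs k
  rw [card_vertexSet hx.1, show (n : ℤ) - ((a : ℤ) - 1) - 1 = n - a by ring] at h
  exact h

theorem mem_boundaries_of_sphereRank_eq_zero (hK : HasSphericalLinks K R n) {a : ℕ}
    {x : Fin a → V} (hx : IsOrderedSimplex K x) {k : ℕ} (hk : sphereRank ((n : ℤ) - a) k = 0)
    {g : (Fin (k + 1) → V) →₀ R} (hg : g ∈ cycles (link K (vertexSet x)) R (k + 1)) :
    g ∈ boundaries (link K (vertexSet x)) R (k + 1) := by
  obtain ⟨e⟩ := hK.link_homology hx k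
  rw [hk] at e
  exact (mkQ_subquotient_eq_zero_iff ⟨g, hg⟩).1 (e.injective (Subsingleton.elim _ _))

theorem cycles_one_eq : cycles K R 1 = chains K R 1 := by
  refine le_antisymm inf_le_left fun c hc => ⟨hc, ?_⟩
  have := boundary_mem_chains hc
  rw [chains_zero_eq_bot] at this
  exact this

theorem isOrderedSimplex_link_single_iff {a : ℕ} {x : Fin a → V} (hx : Function.Injective x)
    {z : Fin 1 → V} : IsOrderedSimplex (link K (vertexSet x)) z ↔
      IsOrderedSimplex K (Fin.cons (z 0) x : Fin (a + 1) → V) := by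
  rw [isOrderedSimplex_link_iff (Nat.add_comm 1 a) (by simp) hx, joinTuple_one]

/-- If the degree-zero homology vanished, the vertex `v` of the link would be a boundary, although
its augmentation is `1`. -/
theorem sphereRank_zero_ne_zero_of_cons [Nontrivial R] (hK : HasSphericalLinks K R n) {a : ℕ}
    {x : Fin a → V} (hx : IsOrderedSimplex K x) {v : V}
    (hv : IsOrderedSimplex K (Fin.cons v x : Fin (a + 1) → V)) :
    sphereRank ((n : ℤ) - a) 0 ≠ 0 := by
  intro h0
  have hz : IsOrderedSimplex (link K (vertexSet x)) (fun _ : Fin 1 => v) :=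
    (isOrderedSimplex_link_single_iff hx.1).2 hv
  have hc := single_mem_chains hz (1 : R)
  rw [← cycles_one_eq] at hc
  obtain ⟨g, hg, hgv⟩ := mem_boundaries_of_sphereRank_eq_zero hK hx (k := 0) h0 hc
  have h1 := augmentation_boundary_link hx hg
  rw [hgv] at h1
  simp [augmentation] at h1

/-- Simplices of a complex with spherical links have at most `n + 1` vertices. -/
theorem HasSphericalLinks.card_le [Nontrivial R] (hK : HasSphericalLinks K R n) {a : ℕ}
    {x : Fin a → V} (hx : IsOrderedSimplex K x) : a ≤ n + 1 := by
  by_contra! h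
  -- The link of this face should have the homology of the empty `(-1)`-sphere, yet it contains the
  -- next vertex of `x`.
  let x' : Fin (n + 1) → V := fun i => x (Fin.castLE (by omega) i)
  have hi : Function.Injective x' := hx.1.comp (Fin.castLE_injective _)
  have hx' : IsOrderedSimplex K x' := hx.of_range_subset (by simp) hi (range_comp_subset x _)
  have hv : IsOrderedSimplex K (Fin.cons (x ⟨n + 1, h⟩) x' : Fin (n + 2) → V) := by
    refine hx.of_range_subset (by simp) (Fin.cons_injective_iff.2 ⟨?_, hi⟩) ?_
    · rintro ⟨i, hi⟩
      have := congrArg Fin.val (hx.1 hi)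
      have h2 := i.isLt
      simp only [Fin.val_castLE] at this
      omega
    · rw [Fin.range_cons, Set.insert_subset_iff]
      exact ⟨⟨_, rfl⟩, range_comp_subset x _⟩
  refine sphereRank_zero_ne_zero_of_cons hK hx' hv ?_
  unfold sphereRank
  rw [if_pos (by push_cast; omega)]

theorem HasSphericalLinks.chains_eq_bot [Nontrivial R] (hK : HasSphericalLinks K R n) {k : ℕ}
    (hk : n + 1 < k) : chains K R k = ⊥ := by
  rw [eq_bot_iff]
  intro c hc
  refine Finsupp.ext fun y => ?_
  by_contra h
  have := hK.card_le (isOrderedSimplex_of_mem_chains hc h)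
  omega

theorem HasSphericalLinks.link_chains_eq_bot [Nontrivial R] (hK : HasSphericalLinks K R n)
    {a k : ℕ} {x : Fin a → V} (hx : Function.Injective x) (hk : n + 1 < k + 1 + a) :
    chains (link K (vertexSet x)) R (k + 1) = ⊥ := by
  rw [eq_bot_iff]
  intro c hc
  refine Finsupp.ext fun y => ?_
  by_contra h
  have := hK.card_le ((isOrderedSimplex_link_iff rfl (by simp) hx).1
    (isOrderedSimplex_of_mem_chains hc h))
  omega

/-- Nonzero homology requires nonzero chains. This is how simplices of the link are found. -/
theorem exists_joinTuple_of_sphereRank_ne_zero [Nontrivial R] (hK : HasSphericalLinks K R n)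
    {a b : ℕ} {x : Fin a → V} (hx : IsOrderedSimplex K x) {k : ℕ}
    (hk : sphereRank ((n : ℤ) - a) k ≠ 0) (h : k + 1 + a = b) :
    ∃ z : Fin (k + 1) → V, IsOrderedSimplex K (joinTuple h z x) := by
  by_contra! h0
  obtain ⟨e⟩ := hK.link_homology hx k
  have : NeZero (sphereRank ((n : ℤ) - a) k) := ⟨hk⟩
  refine one_ne_zero (α := Fin (sphereRank ((n : ℤ) - a) k) → R) ?_
  rw [← e.apply_symm_apply 1]
  obtain ⟨⟨g, hg⟩, hge⟩ := Submodule.mkQ_surjective _ (e.symm 1)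
  have hgc : g ∈ chains (link K (vertexSet x)) R (k + 1) := hg.1
  have : g = 0 := by
    ext z
    by_contra hz
    exact h0 z ((isOrderedSimplex_link_iff h (by simp) hx.1).1
      (isOrderedSimplex_of_mem_chains hgc hz))
  subst this
  rw [← hge]
  have : (⟨0, hg⟩ : cycles (link K (vertexSet x)) R (k + 1)) = 0 := rfl
  rw [this, map_zero, map_zero]

/-- Every simplex is a face of a simplex with `n + 1` vertices. -/
theorem HasSphericalLinks.exists_top [Nontrivial R] (hK : HasSphericalLinks K R n) {a : ℕ}
    {x : Fin a → V} (hx : IsOrderedSimplex K x) :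
    ∃ y : Fin (n + 1) → V, IsOrderedSimplex K y ∧ Set.range x ⊆ Set.range y := by
  rcases (hK.card_le hx).eq_or_lt with rfl | h
  · exact ⟨x, hx, subset_rfl⟩
  · obtain ⟨z, hz⟩ := exists_joinTuple_of_sphereRank_ne_zero hK hx (k := n - a) (b := n + 1) (by
      unfold sphereRank
      rw [if_neg (by omega), if_pos (c := ((n - a : ℕ) : ℤ) = (n : ℤ) - a) (by omega)]
      omega) (by omega)
    refine ⟨_, hz, ?_⟩
    rw [range_joinTuple]
    exact Set.subset_union_right

/-- Every simplex with `n` vertices is a face of exactly two simplices with `n + 1` vertices. -/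
theorem HasSphericalLinks.exists_two [Nontrivial R] (hK : HasSphericalLinks K R n)
    {x : Fin n → V} (hx : IsOrderedSimplex K x) :
    ∃ u v, u ≠ v ∧ ∀ t, IsOrderedSimplex K (Fin.cons t x : Fin (n + 1) → V) ↔ t = u ∨ t = v := by
  obtain ⟨e⟩ := hK.link_homology hx 0
  have hr : sphereRank ((n : ℤ) - n) (0 : ℕ) = 2 := by simp [sphereRank]
  rw [hr] at e
  let S := {v // IsOrderedSimplex K (Fin.cons v x : Fin (n + 1) → V)}
  let ι : S → (Fin 1 → V) := fun s _ => s.1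
  have hι : Function.Injective ι := fun s t h => Subtype.ext (congrFun h 0)
  have hmem : ∀ g : S →₀ R,
      Finsupp.lmapDomain R R ι g ∈ cycles (link K (vertexSet x)) R (0 + 1) := by
    intro g
    rw [cycles_one_eq]
    induction g using Finsupp.induction_linear with
    | zero => simp
    | add f g hf hg => rw [map_add]; exact add_mem hf hg
    | single s r =>
      rw [Finsupp.lmapDomain_apply, Finsupp.mapDomain_single]
      exact single_mem_chains ((isOrderedSimplex_link_single_iff hx.1).2 s.2) r
  -- The link has no edges, as these would give simplices with `n + 2` vertices, so its degree-zero
  -- homology is free on its vertices; comparing ranks with a 0-sphere gives exactly two.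
  let f : (S →₀ R) →ₗ[R] Subquotient (cycles (link K (vertexSet x)) R (0 + 1))
      (boundaries (link K (vertexSet x)) R (0 + 1)) :=
    (Submodule.mkQ _).comp ((Finsupp.lmapDomain R R ι).codRestrict _ hmem)
  have hf : Function.Bijective f := by
    constructor
    · rw [injective_iff_map_eq_zero]
      intro g hg
      have hg' : Finsupp.lmapDomain R R ι g ∈ boundaries (link K (vertexSet x)) R (0 + 1) :=
        (mkQ_subquotient_eq_zero_iff _).1 hg
      rw [boundaries, hK.link_chains_eq_bot hx.1 (by omega), Submodule.map_bot] at hg'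
      exact Finsupp.mapDomain_injective hι (by simpa using hg')
    · intro q
      obtain ⟨⟨c, hc⟩, rfl⟩ := Submodule.mkQ_surjective _ q
      refine ⟨c.comapDomain ι hι.injOn, ?_⟩
      refine congrArg (Submodule.mkQ _) (Subtype.ext ?_)
      refine Finsupp.mapDomain_comapDomain ι hι c ?_
      intro z hz
      have hc' : c ∈ chains (link K (vertexSet x)) R 1 := hc.1
      refine ⟨⟨z 0, (isOrderedSimplex_link_single_iff hx.1).1
        (isOrderedSimplex_of_mem_chains hc' (by simpa using hz))⟩, ?_⟩
      ext i
      rw [Subsingleton.elim i 0]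
  have hcard : Nat.card S = 2 := by
    have hb := Module.finrank_eq_nat_card_basis
      ((Finsupp.basisSingleOne (R := R) (ι := S)).map ((LinearEquiv.ofBijective f hf).trans e))
    rw [← hb]
    simp
  obtain ⟨s, t, hst, hu⟩ := Nat.card_eq_two_iff.1 hcard
  refine ⟨s.1, t.1, fun h => hst (Subtype.ext h), fun w => ⟨fun hw => ?_, ?_⟩⟩
  · have : (⟨w, hw⟩ : S) ∈ ({s, t} : Set S) := by rw [hu]; trivial
    rcases this with h | h
    · exact Or.inl (congrArg Subtype.val h)
    · exact Or.inr (congrArg Subtype.val h)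
  · rintro (rfl | rfl)
    · exact s.2
    · exact t.2

/-! ### Exactness of the columns -/

theorem IsOrderedSimplex.ne_zero {a : ℕ} {x : Fin a → V} (hx : IsOrderedSimplex K x) : a ≠ 0 := by
  rintro rfl
  exact not_isOrderedSimplex_zero x hx

theorem card_le_of_range_subset {a b : ℕ} {x : Fin a → V} {y : Fin b → V}
    (hx : Function.Injective x) (hy : Function.Injective y)
    (h : Set.range x ⊆ Set.range y) : a ≤ b := by
  rw [← coe_vertexSet, ← coe_vertexSet, Finset.coe_subset] at h
  simpa [card_vertexSet hx, card_vertexSet hy] using Finset.card_le_card h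

/-- The hypothesis gives some isomorphism of the degree-zero homology of the link with `R`, not one
known to be the augmentation. But the augmentation is surjective, and a surjective endomorphism of
`R` is injective. -/
theorem mem_boundaries_of_augmentation_eq_zero [Nontrivial R] (hK : HasSphericalLinks K R n)
    {a : ℕ} {x : Fin a → V} (hx : IsOrderedSimplex K x) (ha : a < n) {g : (Fin 1 → V) →₀ R}
    (hg : g ∈ chains (link K (vertexSet x)) R 1) (h0 : augmentation V R g = 0) :
    g ∈ boundaries (link K (vertexSet x)) R 1 := by
  obtain ⟨e⟩ := hK.link_homology hx 0
  have hr : sphereRank ((n : ℤ) - a) (0 : ℕ) = 1 := by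
    unfold sphereRank
    rw [if_neg (by omega), if_neg (c := ((0 : ℕ) : ℤ) = n - a) (by omega)]
    simp
  obtain ⟨z, hz⟩ := exists_joinTuple_of_sphereRank_ne_zero hK hx (k := 0) (by omega) rfl
  rw [← isOrderedSimplex_link_iff (K := K) rfl (by simp) hx.1] at hz
  rw [hr] at e
  let A : Subquotient (cycles (link K (vertexSet x)) R 1)
      (boundaries (link K (vertexSet x)) R 1) →ₗ[R] R :=
    Submodule.liftQ _ ((augmentation V R).comp (Submodule.subtype _)) (by
      rintro c ⟨d, hd, hdc⟩
      rw [LinearMap.mem_ker, LinearMap.comp_apply, ← hdc]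
      exact augmentation_boundary_link hx hd)
  have hA : Function.Surjective A := by
    intro r
    have hm : Finsupp.single z r ∈ cycles (link K (vertexSet x)) R 1 := by
      rw [cycles_one_eq]
      exact single_mem_chains hz r
    refine ⟨Submodule.Quotient.mk ⟨_, hm⟩, ?_⟩
    change augmentation V R (Finsupp.single z r) = r
    simp [augmentation]
  let e' := e.trans (LinearEquiv.funUnique (Fin 1) R R)
  have hinj : Function.Injective (A.comp e'.symm.toLinearMap) :=
    OrzechProperty.injective_of_surjective_endomorphism _
      (hA.comp e'.symm.surjective)
  have hinj' : Function.Injective A := by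
    intro p q hpq
    refine e'.injective (hinj ?_)
    simpa using hpq
  rw [← cycles_one_eq] at hg
  refine (mkQ_subquotient_eq_zero_iff ⟨g, hg⟩).1 (hinj' ?_)
  rw [map_zero]
  exact h0

theorem starPart_boundary_eq_of_linkPart_eq {k a b : ℕ} (h : k + a = b) {x : Fin a → V}
    (hx : Function.Injective x) {c : (Fin b → V) →₀ R} (hc : c ∈ starChains K R x b)
    {d : (Fin (b + 1) → V) →₀ R} (hd : d ∈ starChains K R x (b + 1))
    (hcd : linkPart R h x (boundary K R b d) = linkPart R h x c) :
    starPart R x (boundary K R b d) = c :=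
  eq_of_linkPart_eq h hx (starPart_mem_starChains x (boundary_mem_chains hd.1)) hc
    (by rw [linkPart_starPart, hcd])

/-- The complex of chains on a star is exact below degree `n`. -/
theorem HasSphericalLinks.exists_boundary_eq [Nontrivial R] (hK : HasSphericalLinks K R n)
    {a b : ℕ} {x : Fin a → V} (hx : IsOrderedSimplex K x) (hb : b ≠ n)
    {c : (Fin (b + 1) → V) →₀ R} (hc : c ∈ starChains K R x (b + 1))
    (hd : starPart R x (boundary K R b c) = 0) :
    ∃ d ∈ starChains K R x (b + 2), starPart R x (boundary K R (b + 1) d) = c := by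
  by_cases h0 : c = 0
  · exact ⟨0, zero_mem _, by rw [map_zero, map_zero, h0]⟩
  obtain ⟨y, hy⟩ := Finsupp.ne_iff.1 h0
  have hyo := isOrderedSimplex_of_mem_chains hc.1 hy
  have h1 := hK.card_le hyo
  have h2 := card_le_of_range_subset hx.1 hyo.1 (hc.2 y hy)
  obtain ⟨k, h⟩ : ∃ k, k + a = b + 1 := ⟨b + 1 - a, by omega⟩
  -- Here `k` counts the link vertices in the simplices of `c`. For `k = 0` a vertex of the link
  -- with coefficient `c x` bounds; for `k = 1` the condition is vanishing augmentation; for larger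
  -- `k` the link has no homology in the relevant degree because `b ≠ n`.
  rcases k with _ | _ | k
  · obtain rfl : a = b + 1 := by omega
    obtain ⟨z, hz⟩ := exists_joinTuple_of_sphereRank_ne_zero hK hx (k := 0) (by
      unfold sphereRank
      rw [if_neg (by omega), if_pos (c := ((0 : ℕ) : ℤ) = 0) (by omega)]
      omega) (Nat.add_comm 1 (b + 1))
    rw [← isOrderedSimplex_link_iff (K := K) _ (by simp) hx.1] at hz
    obtain ⟨d, hd, hdz⟩ := exists_linkPart_eq_of_mem_chains (Nat.add_comm 1 (b + 1)) (by simp) hx.1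
      (single_mem_chains hz (c x))
    refine ⟨d, hd, starPart_boundary_eq_of_linkPart_eq h hx.1 hc hd ?_⟩
    refine Finsupp.ext fun t => ?_
    rw [linkPart_apply, linkPart_apply, joinTuple_zero,
      boundary_apply_eq_augmentation (Nat.add_comm 1 (b + 1)) hx, hdz]
    simp [augmentation]
  · obtain rfl : a = b := by omega
    have hb0 : augmentation V R (linkPart R h x c) = 0 := by
      rw [← boundary_apply_eq_augmentation h hx, ← starPart_apply_of_subset (x := x) subset_rfl, hd]
      rfl
    obtain ⟨g, hg, hgc⟩ := mem_boundaries_of_augmentation_eq_zero hK hx (by omega)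
      (linkPart_mem_chains h (by simp) hx.1 hc.1) hb0
    obtain ⟨d, hd, rfl⟩ :=
      exists_linkPart_eq_of_mem_chains (b := a + 2) (by omega) (by simp) hx.1 hg
    refine ⟨d, hd, starPart_boundary_eq_of_linkPart_eq h hx.1 hc hd ?_⟩
    rw [linkPart_boundary h (by omega) (by simp) hx.1, ← hgc]
  · have hcy : linkPart R h x c ∈ cycles (link K (vertexSet x)) R (k + 1 + 1) := by
      refine ⟨linkPart_mem_chains h (by simp) hx.1 hc.1, ?_⟩
      have h3 : k + 1 + a = b := by omega
      change boundary _ R (k + 1) (linkPart R h x c) = 0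
      rw [← linkPart_boundary h3 h (by simp) hx.1, ← linkPart_starPart, hd, map_zero]
    obtain ⟨g, hg, hgc⟩ := mem_boundaries_of_sphereRank_eq_zero hK hx (by
      unfold sphereRank
      rw [if_neg (by omega), if_neg (c := ((k + 1 : ℕ) : ℤ) = 0) (by omega),
        if_neg (by push_cast; omega)]) hcy
    obtain ⟨d, hd, rfl⟩ :=
      exists_linkPart_eq_of_mem_chains (b := b + 2) (by omega) (by simp) hx.1 hg
    refine ⟨d, hd, starPart_boundary_eq_of_linkPart_eq h hx.1 hc hd ?_⟩
    rw [linkPart_boundary h (by omega) (by simp) hx.1, ← hgc]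

theorem flagChains_mem_starChains {a b : ℕ} {F : FlagFunctions V R a b}
    (hF : F ∈ flagChains K R a b) (x : Fin a → V) : F x ∈ starChains K R x b :=
  ⟨hF.1 x, fun y hy => (hF.2.1 x y hy).2⟩

theorem isOrderedSimplex_of_flagChains_ne_zero {a b : ℕ} (ha : a ≠ 0) {F : FlagFunctions V R a b}
    (hF : F ∈ flagChains K R a b) {x : Fin a → V} (hx : F x ≠ 0) : IsOrderedSimplex K x := by
  obtain ⟨y, hy⟩ := Finsupp.ne_iff.1 hx
  obtain ⟨h1, h2⟩ := hF.2.1 x y hy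
  exact (isOrderedSimplex_of_mem_chains (hF.1 x) hy).of_range_subset ha h1 h2

/-- The columns of the double complex are exact below degree `n`. -/
theorem HasSphericalLinks.exists_simplexDiff_eq [Nontrivial R] (hK : HasSphericalLinks K R n)
    {a b : ℕ} (ha : a ≠ 0) (hb : b ≠ n) {F : FlagFunctions V R a (b + 1)}
    (hF : F ∈ flagChains K R a (b + 1)) (hd : simplexDiff K R a b F = 0) :
    ∃ G ∈ flagChains K R a (b + 2), simplexDiff K R a (b + 1) G = F := by
  have key : ∀ x, ∃ d ∈ starChains K R x (b + 2), (F x = 0 → d = 0) ∧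
      starPart R x (boundary K R (b + 1) d) = F x := by
    intro x
    by_cases h0 : F x = 0
    · exact ⟨0, zero_mem _, fun _ => rfl, by rw [map_zero, map_zero, h0]⟩
    · obtain ⟨d, hd, hdF⟩ := hK.exists_boundary_eq
        (isOrderedSimplex_of_flagChains_ne_zero ha hF h0) hb
        (flagChains_mem_starChains hF x) (congrFun hd x)
      exact ⟨d, hd, fun h => absurd h h0, hdF⟩
  -- The preimages are chosen for each tuple separately, with zero chosen over zero to keep the
  -- support finite. They are then made alternating in `x` using one ordering of each simplex.
  choose D hD hD0 hDF using key
  obtain ⟨G, hG, hG0, hGD⟩ := exists_isAlternating D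
  have hr : ∀ (x : Fin a → V) (π : Equiv.Perm (Fin a)), Set.range (x ∘ π) = Set.range x :=
    fun x π => π.surjective.range_comp x
  have hstar : ∀ x, G x ∈ starChains K R x (b + 2) := by
    intro x
    by_cases hx : Function.Injective x
    · obtain ⟨π, hπ⟩ := hGD x hx
      rw [hπ]
      have h : D (x ∘ π) ∈ starChains K R x (b + 2) :=
        ⟨(hD _).1, fun y hy => hr x π ▸ (hD _).2 y hy⟩
      exact zsmul_mem h _
    · rw [hG0 x hx]
      exact zero_mem _
  refine ⟨G, ⟨fun x => (hstar x).1, fun x y h => ⟨?_, (hstar x).2 y h⟩, hG,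
    hF.2.2.2.subset fun x hx h => hx ?_⟩, ?_⟩
  · by_contra hx
    exact h (by rw [hG0 x hx]; rfl)
  · by_cases hi : Function.Injective x
    · obtain ⟨π, hπ⟩ := hGD x hi
      rw [hπ, hD0, smul_zero]
      rw [hF.2.2.1, h, smul_zero]
    · exact hG0 x hi
  · ext1 x
    rw [simplexDiff_apply]
    by_cases hi : Function.Injective x
    · obtain ⟨π, hπ⟩ := hGD x hi
      rw [hπ, map_zsmul, map_zsmul, ← starPart_congr (hr x π), hDF, hF.2.2.1, smul_smul]
      rcases Int.units_eq_one_or (Equiv.Perm.sign π) with e | e <;> simp [e]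
    · rw [hG0 x hi, flagChains_eq_zero hF hi, map_zero, map_zero]

/-! ### Fundamental classes -/

/-- An alternating function with values `±1` on the top-dimensional simplices whose values on the
simplices around a simplex of codimension one cancel. -/
structure IsFundamentalClass (K : PreAbstractSimplicialComplex V) (R : Type v) [CommRing R]
    (n : ℕ) (ω : (Fin (n + 1) → V) → R) : Prop where
  mem_cochains : ω ∈ cochains K R (n + 1)
  mul_self : ∀ y, IsOrderedSimplex K y → ω y * ω y = 1
  cancel : ∀ (w : Fin n → V) (u v : V), IsOrderedSimplex K w → u ≠ v →
    IsOrderedSimplex K (Fin.cons u w : Fin (n + 1) → V) →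
    IsOrderedSimplex K (Fin.cons v w : Fin (n + 1) → V) →
    ω (Fin.cons u w) = - ω (Fin.cons v w)

open Classical in
/-- The restriction of `ω` to the star of `x`, as a chain if it is finitely supported. -/
def starClass (ω : (Fin (n + 1) → V) → R) {a : ℕ} (x : Fin a → V) : (Fin (n + 1) → V) →₀ R :=
  if h : (Function.support fun y => if Set.range x ⊆ Set.range y then ω y else 0).Finite then
    Finsupp.ofSupportFinite _ h else 0

/-- A simplex containing `x` contains the vertex `x 0`. For the empty tuple the set could be
infinite, which is why `starClass` is used only for `a ≠ 0`. -/
theorem LocallyFinite.finite_setOf (hK : LocallyFinite K) {a b : ℕ} (ha : a ≠ 0)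
    (x : Fin a → V) :
    {y : Fin b → V | IsOrderedSimplex K y ∧ Set.range x ⊆ Set.range y}.Finite := by
  classical
  have : NeZero a := ⟨ha⟩
  refine ((hK (x 0)).biUnion fun s _ => Set.Finite.pi' (ι := Fin b)
    (fun _ => s.finite_toSet)).subset ?_
  rintro y ⟨hy, hxy⟩
  simp only [Set.mem_iUnion]
  refine ⟨Finset.univ.image y, ⟨hy.2, ?_⟩, fun i => by simp⟩
  simpa using hxy ⟨0, rfl⟩

open Classical in
theorem starClass_apply (hK : LocallyFinite K) {ω : (Fin (n + 1) → V) → R}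
    (hω : ω ∈ cochains K R (n + 1)) {a : ℕ} (ha : a ≠ 0) (x : Fin a → V) (y : Fin (n + 1) → V) :
    starClass ω x y = if Set.range x ⊆ Set.range y then ω y else 0 := by
  have : (Function.support fun y => if Set.range x ⊆ Set.range y then ω y else 0).Finite := by
    refine (hK.finite_setOf (b := n + 1) ha x).subset fun y hy => ?_
    rw [Function.mem_support, ne_eq, ite_eq_right_iff, Classical.not_imp] at hy
    refine ⟨?_, hy.1⟩
    by_contra h
    exact hy.2 (hω.1 y h)
  rw [starClass, dif_pos this]
  rfl

theorem starClass_mem_starChains (hK : LocallyFinite K) {ω : (Fin (n + 1) → V) → R}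
    (hω : ω ∈ cochains K R (n + 1)) {a : ℕ} (ha : a ≠ 0) (x : Fin a → V) :
    starClass ω x ∈ starChains K R x (n + 1) := by
  classical
  refine ⟨⟨fun y hy => ?_, fun y π => ?_⟩, fun y hy => ?_⟩
  · change starClass ω x y = 0
    rw [starClass_apply hK hω ha, hω.1 y hy, ite_self]
  · change starClass ω x (y ∘ π) = _ • starClass ω x y
    rw [starClass_apply hK hω ha, starClass_apply hK hω ha, π.surjective.range_comp, hω.2,
      smul_ite, smul_zero]
  · rw [starClass_apply hK hω ha, ne_eq, ite_eq_right_iff, Classical.not_imp] at hy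
    exact hy.1

theorem starClass_apply_of_subset (hK : LocallyFinite K) {ω : (Fin (n + 1) → V) → R}
    (hω : ω ∈ cochains K R (n + 1)) {a : ℕ} (ha : a ≠ 0) {x : Fin a → V} {y : Fin (n + 1) → V}
    (h : Set.range x ⊆ Set.range y) : starClass ω x y = ω y := by
  rw [starClass_apply hK hω ha, if_pos h]

theorem boundary_apply_eq_add {k : ℕ} {x : Fin k → V} (hx : IsOrderedSimplex K x) {u v : V}
    (huv : u ≠ v)
    (h : ∀ t, IsOrderedSimplex K (Fin.cons t x : Fin (k + 1) → V) ↔ t = u ∨ t = v)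
    {c : (Fin (k + 1) → V) →₀ R} (hc : c ∈ chains K R (k + 1)) :
    boundary K R k c x = c (Fin.cons u x) + c (Fin.cons v x) := by
  classical
  rw [boundary_apply, if_pos hx, finsum_eq_sum_of_support_subset (s := {u, v}),
    Finset.sum_pair huv]
  intro t ht
  simpa using (h t).1 (isOrderedSimplex_of_mem_chains hc ht)

/-- Each codimension-one simplex containing `x` lies in exactly two top simplices, both in the star
of `x`, and their contributions cancel. -/
theorem starPart_boundary_starClass [Nontrivial R] (hK : HasSphericalLinks K R n)
    {ω : (Fin (n + 1) → V) → R} (hω : IsFundamentalClass K R n ω) {a : ℕ} (ha : a ≠ 0)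
    (x : Fin a → V) : starPart R x (boundary K R n (starClass ω x)) = 0 := by
  refine Finsupp.ext fun w => ?_
  have hm := starClass_mem_starChains hK.locallyFinite hω.mem_cochains ha x
  by_cases hw : IsOrderedSimplex K w
  · by_cases hx : Set.range x ⊆ Set.range w
    · obtain ⟨u, v, huv, h⟩ := hK.exists_two hw
      have hs : ∀ t, Set.range x ⊆ Set.range (Fin.cons t w : Fin (n + 1) → V) := fun t => by
        rw [Fin.range_cons]
        exact hx.trans (Set.subset_insert _ _)
      rw [starPart_apply_of_subset hx, boundary_apply_eq_add hw huv h hm.1,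
        starClass_apply_of_subset hK.locallyFinite hω.mem_cochains ha (hs u),
        starClass_apply_of_subset hK.locallyFinite hω.mem_cochains ha (hs v),
        hω.cancel w u v hw huv ((h u).2 (Or.inl rfl)) ((h v).2 (Or.inr rfl)), neg_add_cancel]
      rfl
    · rw [starPart_apply_of_not_subset hx]
      rfl
  · exact (starPart_mem_chains x (boundary_mem_chains hm.1)).1 w hw

/-- The top-dimensional cycles on a star are the multiples of the fundamental class. -/
theorem exists_eq_smul_starClass [Nontrivial R] (hK : HasSphericalLinks K R n)
    {ω : (Fin (n + 1) → V) → R} (hω : IsFundamentalClass K R n ω) {a : ℕ} {x : Fin a → V}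
    (hx : IsOrderedSimplex K x) {c : (Fin (n + 1) → V) →₀ R}
    (hc : c ∈ starChains K R x (n + 1)) (hd : starPart R x (boundary K R n c) = 0) :
    ∃ r : R, c = r • starClass ω x := by
  have hsc := starClass_mem_starChains hK.locallyFinite hω.mem_cochains hx.ne_zero x
  have hsa : ∀ {y}, Set.range x ⊆ Set.range y → starClass ω x y = ω y := fun h =>
    starClass_apply_of_subset hK.locallyFinite hω.mem_cochains hx.ne_zero h
  obtain ⟨k, h⟩ : ∃ k, k + a = n + 1 := ⟨n + 1 - a, by have := hK.card_le hx; omega⟩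
  have hsub : ∀ z : Fin k → V, Set.range x ⊆ Set.range (joinTuple h z x) := fun z => by
    rw [range_joinTuple]
    exact Set.subset_union_right
  rcases k with _ | _ | k
  · obtain rfl : a = n + 1 := by omega
    refine ⟨c x * ω x, eq_of_linkPart_eq h hx.1 hc (Submodule.smul_mem _ _ hsc) ?_⟩
    refine Finsupp.ext fun z => ?_
    rw [linkPart_apply, linkPart_apply, Finsupp.smul_apply, hsa (hsub z), joinTuple_zero,
      smul_eq_mul, mul_assoc, hω.mul_self x hx, mul_one]
  · obtain rfl : a = n := by omega
    obtain ⟨u, v, huv, huv'⟩ := hK.exists_two hx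
    have hu := (huv' u).2 (Or.inl rfl)
    have hv := (huv' v).2 (Or.inr rfl)
    have hb : c (Fin.cons u x) + c (Fin.cons v x) = 0 := by
      rw [← boundary_apply_eq_add hx huv huv' hc.1, ← starPart_apply_of_subset (x := x) subset_rfl,
        hd]
      rfl
    refine ⟨c (Fin.cons u x) * ω (Fin.cons u x),
      eq_of_linkPart_eq h hx.1 hc (Submodule.smul_mem _ _ hsc) ?_⟩
    refine Finsupp.ext fun z => ?_
    rw [linkPart_apply, linkPart_apply, Finsupp.smul_apply, hsa (hsub z), joinTuple_one]
    by_cases hz : IsOrderedSimplex K (Fin.cons (z 0) x : Fin (a + 1) → V)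
    · rcases (huv' _).1 hz with e | e
      · rw [e, smul_eq_mul, mul_assoc, hω.mul_self _ hu, mul_one]
      · have h1 := hω.cancel x v u hx huv.symm hv hu
        rw [e, smul_eq_mul, h1, mul_neg, mul_assoc, hω.mul_self _ hu, mul_one]
        exact eq_neg_of_add_eq_zero_right hb
    · have h0 : c (Fin.cons (z 0) x) = 0 := hc.1.1 _ hz
      rw [h0, hω.mem_cochains.1 _ hz, smul_zero]
  · obtain ⟨e⟩ := hK.link_homology hx (k + 1)
    have hr : sphereRank ((n : ℤ) - a) (k + 1 : ℕ) = 1 := by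
      unfold sphereRank
      rw [if_neg (by omega), if_neg (c := ((k + 1 : ℕ) : ℤ) = 0) (by omega),
        if_pos (by push_cast; omega)]
    obtain ⟨z, hz⟩ := exists_joinTuple_of_sphereRank_ne_zero hK hx (k := k + 1) (by omega) h
    rw [hr] at e
    obtain ⟨g, -, hg⟩ := exists_generator_of_subquotient_equiv
      (e.trans (LinearEquiv.funUnique (Fin 1) R R))
      (by rw [boundaries, hK.link_chains_eq_bot hx.1 (by omega), Submodule.map_bot])
    have hcyc : ∀ d ∈ starChains K R x (n + 1), starPart R x (boundary K R n d) = 0 →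
        ∃ r : R, linkPart R h x d = r • g := by
      intro d hd hd0
      refine hg _ ⟨linkPart_mem_chains h (by simp) hx.1 hd.1, ?_⟩
      have h3 : k + 1 + a = n := by omega
      change boundary _ R (k + 1) (linkPart R h x d) = 0
      rw [← linkPart_boundary h3 h (by simp) hx.1, ← linkPart_starPart, hd0, map_zero]
    -- Both `c` and the fundamental class are multiples of a generator `g` of the top homology of
    -- the link. As `ω` is `±1` on a top simplex, its multiple `s` is a unit with inverse `g z * ω
    -- (joinTuple h z x)`.
    obtain ⟨r, hr⟩ := hcyc c hc hd
    obtain ⟨s, hs⟩ := hcyc _ hsc (starPart_boundary_starClass hK hω hx.ne_zero x)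
    have hsz : ω (joinTuple h z x) = s * g z := by
      rw [← hsa (hsub z), ← linkPart_apply, hs]
      rfl
    refine ⟨r * (g z * ω (joinTuple h z x)),
      eq_of_linkPart_eq h hx.1 hc (Submodule.smul_mem _ _ hsc) ?_⟩
    rw [map_smul, hr, hs, smul_smul]
    congr 1
    rw [mul_assoc, mul_right_comm, mul_comm (g z), ← hsz, hω.mul_self _ hz, mul_one]

end SphericalLinks

/-! ### Orientations and fundamental classes -/

section Orientations

variable {V : Type u} {K : PreAbstractSimplicialComplex V} {R : Type v} [CommRing R] {n : ℕ}

theorem isFundamentalClass_of_two_eq_zero (K : PreAbstractSimplicialComplex V)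
    (h2 : (2 : R) = 0) (n : ℕ) :
    IsFundamentalClass K R n (Set.indicator {x | IsOrderedSimplex K x} 1) := by
  have h1 : (-1 : R) = 1 := by
    rw [neg_eq_iff_add_eq_zero, one_add_one_eq_two, h2]
  refine ⟨⟨fun x hx => Set.indicator_of_notMem (s := {x | IsOrderedSimplex K x}) hx _,
    fun x π => ?_⟩, fun y hy => ?_, fun w u v _ _ hu hv => ?_⟩
  · have e : Set.indicator {x | IsOrderedSimplex K x} (1 : (Fin (n + 1) → V) → R) (x ∘ π) =
        Set.indicator {x | IsOrderedSimplex K x} 1 x := by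
      by_cases hx : IsOrderedSimplex K x
      · rw [Set.indicator_of_mem (s := {x | IsOrderedSimplex K x}) hx,
          Set.indicator_of_mem (s := {x | IsOrderedSimplex K x}) (hx.comp π)]
        rfl
      · have hx' : ¬ IsOrderedSimplex K (x ∘ π) := fun h => hx (by
          have := h.comp π⁻¹
          rw [Function.comp_assoc] at this
          simpa using this)
        rw [Set.indicator_of_notMem (s := {x | IsOrderedSimplex K x}) hx,
          Set.indicator_of_notMem (s := {x | IsOrderedSimplex K x}) hx']
    rw [e]
    rcases Int.units_eq_one_or (Equiv.Perm.sign π) with hs | hs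
    · simp [hs]
    · rw [hs, Units.val_neg, Units.val_one, neg_smul, one_smul, neg_eq_neg_one_mul, h1, one_mul]
  · rw [Set.indicator_of_mem (s := {x | IsOrderedSimplex K x}) hy]
    simp
  · rw [Set.indicator_of_mem (s := {x | IsOrderedSimplex K x}) hu,
      Set.indicator_of_mem (s := {x | IsOrderedSimplex K x}) hv]
    exact h1.symm

open Classical in
/-- The function with values `±1` given by an orientation. -/
def Orientation.toFunction (R : Type v) [CommRing R] (o : Orientation K n) :
    (Fin (n + 1) → V) → R :=
  fun x => if h : IsOrderedSimplex K x then ((o.sgn ⟨x, h⟩ : ℤ) : R) else 0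

theorem Orientation.toFunction_apply (o : Orientation K n) {x : Fin (n + 1) → V}
    (h : IsOrderedSimplex K x) : o.toFunction R x = ((o.sgn ⟨x, h⟩ : ℤ) : R) := dif_pos h

theorem Orientation.toFunction_eq_zero (o : Orientation K n) {x : Fin (n + 1) → V}
    (h : ¬ IsOrderedSimplex K x) : o.toFunction R x = 0 := dif_neg h

theorem Orientation.isFundamentalClass (o : Orientation K n) :
    IsFundamentalClass K R n (o.toFunction R) := by
  refine ⟨⟨fun x hx => dif_neg hx, fun x π => ?_⟩, fun y hy => ?_, fun w u v hw huv hu hv => ?_⟩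
  · by_cases hx : IsOrderedSimplex K x
    · rw [o.toFunction_apply hx, o.toFunction_apply (hx.comp π), o.alternating x π hx]
      simp
    · have hx' : ¬ IsOrderedSimplex K (x ∘ π) := fun h => hx (by
        have := h.comp π⁻¹
        rw [Function.comp_assoc] at this
        simpa using this)
      rw [o.toFunction_eq_zero hx, o.toFunction_eq_zero hx', smul_zero]
  · rw [o.toFunction_apply hy]
    rcases Int.units_eq_one_or (o.sgn ⟨y, hy⟩) with h | h <;> simp [h]
  · rw [o.toFunction_apply hu, o.toFunction_apply hv, o.consistent w u v hu hv hw huv]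
    simp

/-- The opposite orientation. -/
def Orientation.opposite (o : Orientation K n) : Orientation K n where
  sgn x := - o.sgn x
  alternating x π hx hπ := by rw [o.alternating x π hx hπ, mul_neg]
  consistent w a b ha hb hw hab := by rw [o.consistent w a b ha hb hw hab]

theorem units_eq_of_cast_eq [Nontrivial R] (h2 : (2 : R) ≠ 0) {s t : ℤˣ}
    (h : ((s : ℤ) : R) = ((t : ℤ) : R)) : s = t := by
  have h1 : (1 : R) ≠ -1 := fun h => h2 (by
    rw [← one_add_one_eq_two]
    exact add_eq_zero_iff_eq_neg.2 h)
  rcases Int.units_eq_one_or s with rfl | rfl <;> rcases Int.units_eq_one_or t with rfl | rfl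
  · rfl
  · exact absurd (by simpa using h) h1
  · exact absurd (by simpa using h.symm) h1
  · rfl

/-- On the star of a vertex, the class of `o'` is a multiple `r` of that of `o`, so the ratio of
their signs is `r` on every top simplex there. Since `2 ≠ 0`, a sign is determined by its image in
`R`. -/
theorem Orientation.mul_eq_mul_of_mem [Nontrivial R] (h2 : (2 : R) ≠ 0)
    (hK : HasSphericalLinks K R n) (o o' : Orientation K n) {v : V}
    (hv : IsOrderedSimplex K fun _ : Fin 1 => v) {y z : Fin (n + 1) → V}
    (hy : IsOrderedSimplex K y) (hz : IsOrderedSimplex K z) (hvy : v ∈ Set.range y)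
    (hvz : v ∈ Set.range z) : o'.sgn ⟨y, hy⟩ * o.sgn ⟨y, hy⟩ = o'.sgn ⟨z, hz⟩ * o.sgn ⟨z, hz⟩ := by
  have hω := o.isFundamentalClass (R := R)
  have hω' := o'.isFundamentalClass (R := R)
  obtain ⟨r, hr⟩ := exists_eq_smul_starClass hK hω hv
    (starClass_mem_starChains hK.locallyFinite hω'.mem_cochains one_ne_zero _)
    (starPart_boundary_starClass hK hω' one_ne_zero _)
  have key : ∀ {t : Fin (n + 1) → V} (ht : IsOrderedSimplex K t), v ∈ Set.range t →
      (((o'.sgn ⟨t, ht⟩ * o.sgn ⟨t, ht⟩ : ℤˣ) : ℤ) : R) = r := by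
    intro t ht hvt
    have hs : Set.range (fun _ : Fin 1 => v) ⊆ Set.range t := by
      rintro _ ⟨_, rfl⟩
      exact hvt
    have h := congrArg (fun c => c t) hr
    simp only [Finsupp.smul_apply] at h
    rw [starClass_apply_of_subset hK.locallyFinite hω.mem_cochains one_ne_zero hs,
      starClass_apply_of_subset hK.locallyFinite hω'.mem_cochains one_ne_zero hs] at h
    rw [Units.val_mul, Int.cast_mul, ← o.toFunction_apply, ← o'.toFunction_apply, h, smul_eq_mul,
      mul_assoc, hω.mul_self t ht, mul_one]
  exact units_eq_of_cast_eq h2 ((key hy hvy).trans (key hz hvz).symm)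

theorem isOrderedSimplex_vertex (L : AbstractSimplicialComplex V) (v : V) :
    IsOrderedSimplex L.toPreAbstractSimplicialComplex fun _ : Fin 1 => v := by
  classical
  refine ⟨fun _ _ _ => Subsingleton.elim _ _, ?_⟩
  have := L.singleton_mem v
  have e : vertexSet (fun _ : Fin 1 => v) = {v} := by simp [vertexSet]
  exact (e.symm ▸ this : vertexSet (fun _ : Fin 1 => v) ∈ L.faces)

theorem isOrderedSimplex_edge {L : AbstractSimplicialComplex V} {v w : V}
    (h : (oneSkeleton L).Adj v w) :
    IsOrderedSimplex L.toPreAbstractSimplicialComplex ![v, w] := by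
  classical
  refine ⟨?_, ?_⟩
  · have hne := h.1
    intro i j hij
    fin_cases i <;> fin_cases j <;> simp_all
  · have e : vertexSet ![v, w] = {v, w} := by
      ext t
      simp [vertexSet, Fin.exists_fin_two, eq_comm]
    have h2 : ({v, w} : Finset V) ∈ L.faces := h.2
    exact (e.symm ▸ h2 : vertexSet ![v, w] ∈ L.faces)

/-- On a connected manifold two orientations agree or are opposite to each other. -/
theorem Orientation.eq_or_eq_opposite [Nontrivial R] (h2 : (2 : R) ≠ 0)
    {L : AbstractSimplicialComplex V}
    (hK : HasSphericalLinks L.toPreAbstractSimplicialComplex R n)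
    (hconn : (oneSkeleton L).Connected)
    (o o' : Orientation L.toPreAbstractSimplicialComplex n) : o' = o ∨ o' = o.opposite := by
  obtain ⟨v₀⟩ := hconn.nonempty
  obtain ⟨y₀, hy₀, hv₀⟩ := hK.exists_top (isOrderedSimplex_vertex L v₀)
  have hv₀' : v₀ ∈ Set.range y₀ := hv₀ ⟨0, rfl⟩
  have key : ∀ v w : V, (oneSkeleton L).Reachable v w → ∀ s : ℤˣ,
      (∀ y (hy : IsOrderedSimplex L.toPreAbstractSimplicialComplex y), v ∈ Set.range y →
        o'.sgn ⟨y, hy⟩ * o.sgn ⟨y, hy⟩ = s) →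
      ∀ y (hy : IsOrderedSimplex L.toPreAbstractSimplicialComplex y), w ∈ Set.range y →
        o'.sgn ⟨y, hy⟩ * o.sgn ⟨y, hy⟩ = s := by
    rintro v w ⟨p⟩ s
    induction p with
    | nil => exact id
    | cons h p ih =>
      intro hs
      refine ih fun y hy hvy => ?_
      -- A top simplex containing the edge lies in the stars of both endpoints and passes the ratio
      -- from one to the other.
      obtain ⟨z, hz, hsub⟩ := hK.exists_top (isOrderedSimplex_edge h)
      rw [o.mul_eq_mul_of_mem h2 hK o' (isOrderedSimplex_vertex L _) hy hz hvy (hsub ⟨1, rfl⟩)]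
      exact hs z hz (hsub ⟨0, rfl⟩)
  have hall : ∀ y (hy : IsOrderedSimplex L.toPreAbstractSimplicialComplex y),
      o'.sgn ⟨y, hy⟩ * o.sgn ⟨y, hy⟩ = o'.sgn ⟨y₀, hy₀⟩ * o.sgn ⟨y₀, hy₀⟩ := fun y hy =>
    key v₀ (y 0) (hconn.preconnected _ _) _
      (fun z hz hvz => o.mul_eq_mul_of_mem h2 hK o' (isOrderedSimplex_vertex L _) hz hy₀ hvz hv₀')
      y hy ⟨0, rfl⟩
  have hmul : ∀ (s t e : ℤˣ), s * t = e → s = e * t := by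
    rintro s t e rfl
    rw [mul_assoc, Int.units_mul_self, mul_one]
  rcases Int.units_eq_one_or (o'.sgn ⟨y₀, hy₀⟩ * o.sgn ⟨y₀, hy₀⟩) with h | h
  · left
    ext1
    funext ⟨y, hy⟩
    rw [hmul _ _ _ ((hall y hy).trans h), one_mul]
  · right
    ext1
    funext ⟨y, hy⟩
    rw [hmul _ _ _ ((hall y hy).trans h), neg_one_mul]
    rfl

theorem Orientation.card_eq_two [Nontrivial R] (h2 : (2 : R) ≠ 0)
    {L : AbstractSimplicialComplex V}
    (hK : HasSphericalLinks L.toPreAbstractSimplicialComplex R n)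
    (hconn : (oneSkeleton L).Connected)
    (o : Orientation L.toPreAbstractSimplicialComplex n) :
    Nat.card (Orientation L.toPreAbstractSimplicialComplex n) = 2 := by
  obtain ⟨v⟩ := hconn.nonempty
  obtain ⟨y, hy, -⟩ := hK.exists_top (isOrderedSimplex_vertex L v)
  refine Nat.card_eq_two_iff.2 ⟨o, o.opposite, fun h => ?_, ?_⟩
  · have := congrArg (fun o => o.sgn ⟨y, hy⟩) h
    exact absurd this (by
      change o.sgn ⟨y, hy⟩ ≠ - o.sgn ⟨y, hy⟩
      rcases Int.units_eq_one_or (o.sgn ⟨y, hy⟩) with h | h <;> rw [h] <;> decide)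
  · exact Set.eq_univ_of_forall fun o' => o.eq_or_eq_opposite h2 hK hconn o'

/-- The sign by which `γ` acts on orientations, as an element of `R`. -/
def orientationSign (K : PreAbstractSimplicialComplex V) (R : Type v) [CommRing R] {Γ : Type w}
    [Group Γ] [MulAction Γ V] [IsSimplicialAction K Γ] (n : ℕ) (γ : Γᵐᵒᵖ) : R :=
  ((orientationCharacter K Γ n γ.unop : ℤ) : R)

theorem orientationSign_mul_self {Γ : Type w} [Group Γ] [MulAction Γ V] [IsSimplicialAction K Γ]
    (γ : Γᵐᵒᵖ) : orientationSign K R n γ * orientationSign K R n γ = 1 := by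
  rw [orientationSign, ← Int.cast_mul, ← Units.val_mul, Int.units_mul_self]
  simp

/-- If `2 = 0`, the invariant function `1` on top simplices works, as every sign becomes `1` in `R`.
Otherwise there is an orientation, and exactly two in all, so `γ` either fixes both or exchanges
them. -/
theorem exists_isFundamentalClass [Nontrivial R] {Γ : Type w} [Group Γ] [MulAction Γ V]
    {L : AbstractSimplicialComplex V} [IsSimplicialAction L.toPreAbstractSimplicialComplex Γ]
    (hK : HasSphericalLinks L.toPreAbstractSimplicialComplex R n)
    (hconn : (oneSkeleton L).Connected)
    (hor : Nonempty (Orientation L.toPreAbstractSimplicialComplex n) ∨ CharP R 2) :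
    ∃ ω : (Fin (n + 1) → V) → R, IsFundamentalClass L.toPreAbstractSimplicialComplex R n ω ∧
      ∀ (γ : Γᵐᵒᵖ) x, ω (γ.unop • x) =
        orientationSign L.toPreAbstractSimplicialComplex R n γ * ω x := by
  by_cases h2 : (2 : R) = 0
  · refine ⟨_, isFundamentalClass_of_two_eq_zero _ h2 n, fun γ x => ?_⟩
    have h1 : orientationSign L.toPreAbstractSimplicialComplex R n γ = 1 := by
      rw [orientationSign]
      rcases Int.units_eq_one_or
        (orientationCharacter L.toPreAbstractSimplicialComplex Γ n γ.unop) with h | h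
      · simp [h]
      · rw [h, Units.val_neg, Units.val_one, Int.cast_neg, Int.cast_one, neg_eq_iff_add_eq_zero,
          one_add_one_eq_two, h2]
    rw [h1, one_mul]
    have := isOrderedSimplex_smul_iff (K := L.toPreAbstractSimplicialComplex) γ.unop (x := x)
    classical
    simp only [Set.indicator, Set.mem_ofPred_eq, this, Pi.one_apply]
  · obtain ⟨o⟩ : Nonempty (Orientation L.toPreAbstractSimplicialComplex n) := by
      refine hor.resolve_right fun h => h2 ?_
      have := CharP.cast_eq_zero R 2
      simpa using this
    refine ⟨_, o.isFundamentalClass, fun γ x => ?_⟩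
    by_cases hx : IsOrderedSimplex L.toPreAbstractSimplicialComplex x
    · have hγx := hx.smul γ.unop
      have hact : ∀ o' : Orientation L.toPreAbstractSimplicialComplex n,
          (γ.unop • o').sgn ⟨γ.unop • x, hγx⟩ = o'.sgn ⟨x, hx⟩ := fun o' => by
        change o'.sgn _ = o'.sgn _
        congr 2
        simp
      rw [o.toFunction_apply hx, o.toFunction_apply hγx, orientationSign,
        orientationCharacter_apply _ Γ n (o.card_eq_two h2 hK hconn)]
      split_ifs with hall
      · rw [← hact o, hall o]
        simp
      · rw [← hact o]
        have : γ.unop • o = o.opposite := by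
          -- Were `o` fixed, injectivity of the action would force its opposite to be fixed too.
          refine (o.eq_or_eq_opposite h2 hK hconn (γ.unop • o)).resolve_left fun h => hall ?_
          intro o'
          rcases o.eq_or_eq_opposite h2 hK hconn o' with rfl | rfl
          · exact h
          · refine (o.eq_or_eq_opposite h2 hK hconn _).resolve_left fun h' => ?_
            have h3 := MulAction.injective γ.unop (h'.trans h.symm)
            have h4 : - o.sgn ⟨x, hx⟩ = o.sgn ⟨x, hx⟩ := congrArg (fun o => o.sgn ⟨x, hx⟩) h3
            rcases Int.units_eq_one_or (o.sgn ⟨x, hx⟩) with h | h <;> rw [h] at h4 <;>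
              exact absurd h4 (by decide)
        rw [this]
        change _ = _ * (((- o.sgn _ : ℤˣ) : ℤ) : R)
        simp
    · have hγx : ¬ IsOrderedSimplex L.toPreAbstractSimplicialComplex (γ.unop • x) := fun h =>
        hx ((isOrderedSimplex_smul_iff γ.unop).1 h)
      rw [o.toFunction_eq_zero hx, o.toFunction_eq_zero hγx, mul_zero]

end Orientations

/-! ### The action on the double complex -/

section Action

variable {V : Type u} {K : PreAbstractSimplicialComplex V} {R : Type v} [CommRing R] {n : ℕ}
  {Γ : Type w} [Group Γ] [MulAction Γ V]

/-- The right action `(F · γ)(x, y) = F(γ x, γ y)`. -/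
def flagRep (V : Type u) (R : Type v) [CommRing R] (Γ : Type w) [Group Γ] [MulAction Γ V]
    (a b : ℕ) : Representation R Γᵐᵒᵖ (FlagFunctions V R a b) where
  toFun γ :=
    { toFun := fun F x => finsuppRep R Γ b γ (F (γ.unop • x))
      map_add' := fun F G => by
        ext1 x
        simp
      map_smul' := fun r F => by
        ext1 x
        simp }
  map_one' := by
    ext F x : 2
    simp
  map_mul' γ δ := by
    ext F x : 2
    simp [mul_smul]

theorem flagRep_apply {a b : ℕ} (γ : Γᵐᵒᵖ) (F : FlagFunctions V R a b) (x : Fin a → V) :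
    flagRep V R Γ a b γ F x = finsuppRep R Γ b γ (F (γ.unop • x)) := rfl

theorem flagRep_apply_apply {a b : ℕ} (γ : Γᵐᵒᵖ) (F : FlagFunctions V R a b) (x : Fin a → V)
    (y : Fin b → V) : flagRep V R Γ a b γ F x y = F (γ.unop • x) (γ.unop • y) :=
  finsuppRep_apply R Γ b γ _ y

theorem range_smul_subset_iff {a b : ℕ} (γ : Γ) {x : Fin a → V} {y : Fin b → V} :
    Set.range (γ • x) ⊆ Set.range (γ • y) ↔ Set.range x ⊆ Set.range y := by
  have h : ∀ {k : ℕ} (z : Fin k → V), Set.range (γ • z) = (fun v => γ • v) '' Set.range z :=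
    fun z => Set.range_comp (fun v => γ • v) z
  rw [h, h]
  exact Set.image_subset_image_iff (MulAction.injective γ)

theorem starPart_finsuppRep {a b : ℕ} (γ : Γᵐᵒᵖ) (x : Fin a → V) (c : (Fin b → V) →₀ R) :
    starPart R x (finsuppRep R Γ b γ c) = finsuppRep R Γ b γ (starPart R (γ.unop • x) c) := by
  ext y
  rw [finsuppRep_apply]
  by_cases h : Set.range x ⊆ Set.range y
  · rw [starPart_apply_of_subset h, starPart_apply_of_subset ((range_smul_subset_iff _).2 h),
      finsuppRep_apply]
  · rw [starPart_apply_of_not_subset h,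
      starPart_apply_of_not_subset fun h' => h ((range_smul_subset_iff _).1 h')]

theorem faceDiff_flagRep {a b : ℕ} (γ : Γᵐᵒᵖ) (F : FlagFunctions V R a b) :
    faceDiff V R a b (flagRep V R Γ a b γ F) =
      flagRep V R Γ (a + 1) b γ (faceDiff V R a b F) := by
  ext1 z
  rw [faceDiff_apply, flagRep_apply, faceDiff_apply, ← starPart_finsuppRep]
  congr 1
  simp only [faceSum, map_sum, map_zsmul]
  rfl

theorem simplexDiff_flagRep [IsSimplicialAction K Γ] {a b : ℕ} (γ : Γᵐᵒᵖ)
    (F : FlagFunctions V R a (b + 1)) :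
    simplexDiff K R a b (flagRep V R Γ a (b + 1) γ F) =
      flagRep V R Γ a b γ (simplexDiff K R a b F) := by
  ext1 x
  rw [simplexDiff_apply, flagRep_apply, flagRep_apply, simplexDiff_apply, boundary_finsuppRep,
    starPart_finsuppRep]

theorem flagRep_mem [IsSimplicialAction K Γ] {a b : ℕ} (γ : Γᵐᵒᵖ) {F : FlagFunctions V R a b}
    (hF : F ∈ flagChains K R a b) : flagRep V R Γ a b γ F ∈ flagChains K R a b := by
  refine ⟨fun x => finsuppRep_mem_chains γ (hF.1 _), fun x y h => ?_, fun x π => ?_,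
    (hF.2.2.2.preimage (MulAction.injective γ.unop).injOn).subset fun x hx h => hx ?_⟩
  · rw [flagRep_apply_apply] at h
    obtain ⟨h1, h2⟩ := hF.2.1 _ _ h
    exact ⟨fun i j hij => h1 (congrArg (γ.unop • ·) hij), (range_smul_subset_iff _).1 h2⟩
  · rw [flagRep_apply, flagRep_apply, ← map_zsmul, ← hF.2.2.1]
    rfl
  · change finsuppRep R Γ b γ (F (γ.unop • x)) = 0
    rw [h, map_zero]

/-! ### The correspondences along the double complex -/

/-- The elements of the double complex killed by both differentials. -/
def flagCycles (K : PreAbstractSimplicialComplex V) (R : Type v) [CommRing R] (a b : ℕ) :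
    Submodule R (FlagFunctions V R a (b + 1)) :=
  flagChains K R a (b + 1) ⊓ LinearMap.ker (faceDiff V R a (b + 1)) ⊓
    LinearMap.ker (simplexDiff K R a b)

/-- The boundaries of elements killed by the differential in the other direction. -/
def simplexBoundaries (K : PreAbstractSimplicialComplex V) (R : Type v) [CommRing R] (a b : ℕ) :
    Submodule R (FlagFunctions V R a (b + 1)) :=
  (flagChains K R a (b + 2) ⊓ LinearMap.ker (faceDiff V R a (b + 2))).map
    (simplexDiff K R a (b + 1))

/-- The coboundaries of elements killed by the differential in the other direction. -/
def faceBoundaries (K : PreAbstractSimplicialComplex V) (R : Type v) [CommRing R] (a b : ℕ) :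
    Submodule R (FlagFunctions V R (a + 1) (b + 1)) :=
  (flagChains K R a (b + 1) ⊓ LinearMap.ker (simplexDiff K R a b)).map (faceDiff V R a (b + 1))

variable [IsSimplicialAction K Γ]

/-- One stair: an element `F` relates its boundary to its coboundary. Column exactness lifts
elements of the first side, row exactness those of the second. If one component is the differential
of some `G` killed by the other differential, `F - G` shows that the other component is a boundary
of the required kind. -/
theorem corresponds_step [Nontrivial R] (hK : HasSphericalLinks K R n) {a b : ℕ} (ha : a ≠ 0)
    (hb : b ≠ n) :
    Corresponds (fun _ => 1) (flagRep V R Γ a (b + 1)) (flagCycles K R a b)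
      (simplexBoundaries K R a b) (flagRep V R Γ (a + 1) (b + 2)) (flagCycles K R (a + 1) (b + 1))
      (faceBoundaries K R a (b + 1)) := by
  refine ⟨(flagChains K R a (b + 2) ⊓
    LinearMap.ker ((simplexDiff K R (a + 1) (b + 1)).comp (faceDiff V R a (b + 2)))).map
      ((simplexDiff K R a (b + 1)).prod (faceDiff V R a (b + 2))), ?_, ?_, ?_, ?_, ?_⟩
  · rintro _ ⟨F, ⟨hF, hF'⟩, rfl⟩
    have hF' : simplexDiff K R (a + 1) (b + 1) (faceDiff V R a (b + 2) F) = 0 := hF'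
    exact ⟨⟨⟨simplexDiff_mem hF, (faceDiff_simplexDiff F).trans hF'⟩, simplexDiff_simplexDiff hF⟩,
      ⟨⟨faceDiff_mem hF, faceDiff_faceDiff F⟩, hF'⟩⟩
  · rintro z ⟨⟨hz, hz1⟩, hz2⟩
    obtain ⟨F, hF, rfl⟩ := hK.exists_simplexDiff_eq ha hb hz hz2
    exact ⟨faceDiff V R a (b + 2) F, F, ⟨hF, (faceDiff_simplexDiff F).symm.trans hz1⟩, rfl⟩
  · rintro z ⟨⟨hz, hz1⟩, hz2⟩
    obtain ⟨F, hF, rfl⟩ := exists_faceDiff_eq hz hz1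
    exact ⟨simplexDiff K R a (b + 1) F, F, ⟨hF, hz2⟩, rfl⟩
  · rintro _ ⟨F, ⟨hF, hF'⟩, rfl⟩
    constructor
    · rintro ⟨G, ⟨hG, hG'⟩, hGF⟩
      have hG' : faceDiff V R a (b + 2) G = 0 := hG'
      have hGF : simplexDiff K R a (b + 1) G = simplexDiff K R a (b + 1) F := hGF
      refine ⟨F - G, ⟨sub_mem hF hG, ?_⟩, ?_⟩
      · rw [SetLike.mem_coe, LinearMap.mem_ker, map_sub, hGF, sub_self]
      · rw [map_sub, hG', sub_zero]
        rfl
    · rintro ⟨G, ⟨hG, hG'⟩, hGF⟩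
      have hG' : simplexDiff K R a (b + 1) G = 0 := hG'
      have hGF : faceDiff V R a (b + 2) G = faceDiff V R a (b + 2) F := hGF
      refine ⟨F - G, ⟨sub_mem hF hG, ?_⟩, ?_⟩
      · rw [SetLike.mem_coe, LinearMap.mem_ker, map_sub, hGF, sub_self]
      · rw [map_sub, hG', sub_zero]
        rfl
  · rintro γ _ ⟨F, ⟨hF, hF'⟩, rfl⟩
    have hF' : simplexDiff K R (a + 1) (b + 1) (faceDiff V R a (b + 2) F) = 0 := hF'
    refine ⟨flagRep V R Γ a (b + 2) γ F, ⟨flagRep_mem γ hF, ?_⟩, ?_⟩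
    · rw [SetLike.mem_coe, LinearMap.mem_ker, LinearMap.comp_apply, faceDiff_flagRep,
        simplexDiff_flagRep, hF', map_zero]
    · rw [one_smul]
      exact Prod.ext (simplexDiff_flagRep γ F) (faceDiff_flagRep γ F)

/-- By exactness of columns and of rows respectively, both sides are the images of the composite of
the two differentials. This is what lets consecutive stairs be composed. -/
theorem faceBoundaries_eq [Nontrivial R] (hK : HasSphericalLinks K R n) {a b : ℕ} (ha : a ≠ 0)
    (hb : b ≠ n) : faceBoundaries K R a b = simplexBoundaries K R (a + 1) b := by
  refine le_antisymm ?_ ?_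
  · rintro _ ⟨F, ⟨hF, hF'⟩, rfl⟩
    obtain ⟨G, hG, rfl⟩ := hK.exists_simplexDiff_eq ha hb hF hF'
    exact ⟨faceDiff V R a (b + 2) G, ⟨faceDiff_mem hG, faceDiff_faceDiff G⟩,
      (faceDiff_simplexDiff G).symm⟩
  · rintro _ ⟨F, ⟨hF, hF'⟩, rfl⟩
    obtain ⟨G, hG, rfl⟩ := exists_faceDiff_eq hF hF'
    exact ⟨simplexDiff K R a (b + 1) G, ⟨simplexDiff_mem hG, simplexDiff_simplexDiff hG⟩,
      faceDiff_simplexDiff G⟩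

/-- Chains as elements of the double complex over the empty face. -/
def constFlag (V : Type u) (R : Type v) [CommRing R] (b : ℕ) :
    ((Fin b → V) →₀ R) →ₗ[R] FlagFunctions V R 0 b :=
  LinearMap.pi fun _ => LinearMap.id

theorem constFlag_injective {b : ℕ} : Function.Injective (constFlag V R b) := fun _ _ h =>
  congrFun h Fin.elim0

theorem constFlag_mem {b : ℕ} {c : (Fin b → V) →₀ R} (hc : c ∈ chains K R b) :
    constFlag V R b c ∈ flagChains K R 0 b := by
  refine ⟨fun _ => hc, fun x y _ => ⟨Function.injective_of_subsingleton x, ?_⟩, fun x π => ?_,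
    Set.toFinite _⟩
  · rw [Set.range_eq_empty]
    exact Set.empty_subset _
  · rw [Subsingleton.elim π 1]
    simp

theorem exists_constFlag_eq {b : ℕ} {F : FlagFunctions V R 0 b} (hF : F ∈ flagChains K R 0 b) :
    ∃ c ∈ chains K R b, constFlag V R b c = F :=
  ⟨F Fin.elim0, hF.1 _, funext fun x => by rw [Subsingleton.elim x Fin.elim0]; rfl⟩

theorem simplexDiff_constFlag {b : ℕ} (c : (Fin (b + 1) → V) →₀ R) :
    simplexDiff K R 0 b (constFlag V R (b + 1) c) = constFlag V R b (boundary K R b c) := by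
  ext1 x
  rw [simplexDiff_apply]
  refine starPart_eq_self fun y _ => ?_
  rw [Set.range_eq_empty]
  exact Set.empty_subset _

/-- The start of the staircase: the augmentation embeds chains as the kernel of the row differential
at `a = 1`. -/
theorem corresponds_cycles (b : ℕ) :
    Corresponds (fun _ => 1) (finsuppRep R Γ (b + 1)) (cycles K R (b + 1)) (boundaries K R (b + 1))
      (flagRep V R Γ 1 (b + 1)) (flagCycles K R 1 b) (simplexBoundaries K R 1 b) := by
  refine Corresponds.of_linearMap ((faceDiff V R 0 (b + 1)).comp (constFlag V R (b + 1)))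
    (cycles_le_comap _) ?_ ?_ ?_ ?_
  · rintro z ⟨hz, hz'⟩
    refine ⟨⟨faceDiff_mem (constFlag_mem hz), faceDiff_faceDiff _⟩, ?_⟩
    have hz' : boundary K R b z = 0 := hz'
    rw [SetLike.mem_coe, LinearMap.mem_ker, LinearMap.comp_apply, ← faceDiff_simplexDiff,
      simplexDiff_constFlag, hz', map_zero, map_zero]
  · rintro F ⟨⟨hF, hF1⟩, hF2⟩
    obtain ⟨G, hG, rfl⟩ := exists_faceDiff_eq hF hF1
    obtain ⟨c, hc, rfl⟩ := exists_constFlag_eq hG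
    refine ⟨c, ⟨hc, ?_⟩, rfl⟩
    rw [SetLike.mem_coe, LinearMap.mem_ker, ← faceDiff_simplexDiff] at hF2
    have h0 := eq_zero_of_faceDiff_eq_zero (simplexDiff_mem hG) hF2
    rw [simplexDiff_constFlag] at h0
    exact constFlag_injective (h0.trans (map_zero _).symm)
  · rintro z ⟨hz, -⟩
    constructor
    · rintro ⟨c, hc, rfl⟩
      refine ⟨faceDiff V R 0 (b + 2) (constFlag V R (b + 2) c),
        ⟨faceDiff_mem (constFlag_mem hc), faceDiff_faceDiff _⟩, ?_⟩
      rw [LinearMap.comp_apply, ← faceDiff_simplexDiff, simplexDiff_constFlag]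
    · rintro ⟨F, ⟨hF, hF'⟩, hFz⟩
      obtain ⟨G, hG, rfl⟩ := exists_faceDiff_eq hF hF'
      obtain ⟨c, hc, rfl⟩ := exists_constFlag_eq hG
      refine ⟨c, hc, ?_⟩
      rw [LinearMap.comp_apply, ← faceDiff_simplexDiff, ← sub_eq_zero, ← map_sub] at hFz
      have h0 := eq_zero_of_faceDiff_eq_zero
        (sub_mem (simplexDiff_mem hG) (constFlag_mem hz)) hFz
      rw [simplexDiff_constFlag, ← map_sub] at h0
      exact sub_eq_zero.1 (constFlag_injective (h0.trans (map_zero _).symm))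
  · intro γ z _
    rw [one_smul, LinearMap.comp_apply, LinearMap.comp_apply, ← faceDiff_flagRep]
    rfl

theorem corresponds_cycles_flagCycles [Nontrivial R] (hK : HasSphericalLinks K R n) (a b : ℕ)
    (h : a + b < n) :
    Corresponds (fun _ => 1) (finsuppRep R Γ (b + 1)) (cycles K R (b + 1)) (boundaries K R (b + 1))
      (flagRep V R Γ (a + 1) (a + b + 1)) (flagCycles K R (a + 1) (a + b))
      (simplexBoundaries K R (a + 1) (a + b)) := by
  induction a with
  | zero =>
    rw [zero_add, zero_add]
    exact corresponds_cycles b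
  | succ a ih =>
    have h1 := (ih (by omega)).trans
      (corresponds_step (Γ := Γ) hK (a := a + 1) (b := a + b) (by omega) (by omega))
    rw [faceBoundaries_eq hK (by omega) (by omega)] at h1
    simp only [mul_one] at h1
    rw [show a + 1 + b = a + b + 1 by omega]
    exact h1

/-! ### Compactly supported cochains in the double complex -/

/-- The product of a cochain with a fundamental class. -/
def mulClass (ω : (Fin (n + 1) → V) → R) (k : ℕ) :
    ((Fin k → V) → R) →ₗ[R] FlagFunctions V R k (n + 1) where
  toFun f x := f x • starClass ω x
  map_add' f g := by
    ext1 x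
    simp only [Pi.add_apply, add_smul]
  map_smul' r f := by
    ext1 x
    simp only [Pi.smul_apply, smul_assoc, RingHom.id_apply]

theorem mulClass_apply (ω : (Fin (n + 1) → V) → R) {k : ℕ} (f : (Fin k → V) → R)
    (x : Fin k → V) : mulClass ω k f x = f x • starClass ω x := rfl

variable {ω : (Fin (n + 1) → V) → R}

theorem eq_zero_of_smul_starClass_eq_zero [Nontrivial R] (hK : HasSphericalLinks K R n)
    (hω : IsFundamentalClass K R n ω) {k : ℕ} {x : Fin k → V} (hx : IsOrderedSimplex K x) {r : R}
    (hr : r • starClass ω x = 0) : r = 0 := by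
  obtain ⟨y, hy, hxy⟩ := hK.exists_top hx
  have h := congrArg (fun c => c y) hr
  simp only [Finsupp.smul_apply, Finsupp.zero_apply, smul_eq_mul] at h
  rw [starClass_apply_of_subset hK.locallyFinite hω.mem_cochains hx.ne_zero hxy] at h
  rw [← mul_one r, ← hω.mul_self y hy, ← mul_assoc, h, zero_mul]

theorem starClass_congr (hK : LocallyFinite K) (hω : ω ∈ cochains K R (n + 1)) {k : ℕ}
    (hk : k ≠ 0) {x x' : Fin k → V} (h : Set.range x = Set.range x') :
    starClass ω x = starClass ω x' := by
  ext y
  by_cases hy : Set.range x ⊆ Set.range y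
  · rw [starClass_apply_of_subset hK hω hk hy, starClass_apply_of_subset hK hω hk (h ▸ hy)]
  · classical
    rw [starClass_apply hK hω hk, starClass_apply hK hω hk, if_neg hy, if_neg (h ▸ hy)]

theorem mulClass_injective [Nontrivial R] (hK : HasSphericalLinks K R n)
    (hω : IsFundamentalClass K R n ω) {k : ℕ} {f g : (Fin k → V) → R}
    (hf : ∀ x, ¬ IsOrderedSimplex K x → f x = 0) (hg : ∀ x, ¬ IsOrderedSimplex K x → g x = 0)
    (h : mulClass ω k f = mulClass ω k g) : f = g := by
  ext x
  by_cases hx : IsOrderedSimplex K x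
  · have h1 := congrFun h x
    rw [mulClass_apply, mulClass_apply, ← sub_eq_zero, ← sub_smul] at h1
    exact sub_eq_zero.1 (eq_zero_of_smul_starClass_eq_zero hK hω hx h1)
  · rw [hf x hx, hg x hx]

theorem mulClass_mem (hK : HasSphericalLinks K R n) (hω : IsFundamentalClass K R n ω) {k : ℕ}
    (hk : k ≠ 0) {f : (Fin k → V) → R} (hf : f ∈ compactCochains K R k) :
    mulClass ω k f ∈ flagChains K R k (n + 1) := by
  have hs := fun x : Fin k → V =>
    starClass_mem_starChains hK.locallyFinite hω.mem_cochains hk x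
  refine ⟨fun x => Submodule.smul_mem _ _ (hs x).1, fun x y h => ?_, fun x π => ?_,
    hf.2.subset fun x hx h => hx ?_⟩
  · rw [mulClass_apply, Finsupp.smul_apply] at h
    refine ⟨?_, (hs x).2 y (right_ne_zero_of_smul h)⟩
    by_contra hx
    exact left_ne_zero_of_smul h (hf.1.1 x fun h' => hx h'.1)
  · rw [mulClass_apply, mulClass_apply, hf.1.2, starClass_congr hK.locallyFinite hω.mem_cochains hk
      (π.surjective.range_comp x), smul_assoc]
  · rw [mulClass_apply, h, zero_smul]

theorem simplexDiff_mulClass [Nontrivial R] (hK : HasSphericalLinks K R n)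
    (hω : IsFundamentalClass K R n ω) {k : ℕ} (hk : k ≠ 0) (f : (Fin k → V) → R) :
    simplexDiff K R k n (mulClass ω k f) = 0 := by
  ext1 x
  rw [simplexDiff_apply, mulClass_apply, map_smul, map_smul,
    starPart_boundary_starClass hK hω hk, smul_zero]
  rfl

/-- On a pair `z ⊆ y`, every face of `z` also lies in `y`, so the same factor `ω y` occurs in all
terms and comes out of the sum. -/
theorem faceDiff_mulClass (hK : HasSphericalLinks K R n) (hω : IsFundamentalClass K R n ω) {k : ℕ}
    (hk : k ≠ 0) {f : (Fin k → V) → R} (hf : f ∈ compactCochains K R k) :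
    faceDiff V R k (n + 1) (mulClass ω k f) = mulClass ω (k + 1) (coboundary K R k f) := by
  classical
  ext z y
  rw [mulClass_apply, Finsupp.smul_apply,
    starClass_apply hK.locallyFinite hω.mem_cochains k.succ_ne_zero]
  by_cases hzy : Set.range z ⊆ Set.range y
  swap
  · rw [faceDiff_apply, starPart_apply_of_not_subset hzy, if_neg hzy, smul_zero]
  rw [if_pos hzy]
  by_cases hz : IsOrderedSimplex K z
  · have h1 : coboundary K R k f z = ∑ j : Fin (k + 1), (-1 : R) ^ (j : ℕ) * f (z ∘ j.succAbove) :=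
      if_pos hz
    rw [faceDiff_apply, starPart_apply_of_subset hzy, faceSum_finsupp_apply, h1, faceSum,
      Finset.sum_smul]
    refine Finset.sum_congr rfl fun j _ => ?_
    rw [mulClass_apply, Finsupp.smul_apply, starClass_apply_of_subset hK.locallyFinite
      hω.mem_cochains hk ((range_comp_subset z _).trans hzy)]
    simp [mul_assoc]
  · have h1 : coboundary K R k f z = 0 := if_neg hz
    rw [h1, zero_smul]
    by_contra h0
    have hm := faceDiff_mem (mulClass_mem hK hω hk hf)
    obtain ⟨h2, h3⟩ := hm.2.1 z y h0
    exact hz ((isOrderedSimplex_of_mem_chains (hm.1 z) h0).of_range_subset k.succ_ne_zero h2 h3)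

/-- Each column value is a multiple of the local fundamental class. The coefficient is unique,
because the class takes a value `±1` on some top simplex, and so inherits alternation and finite
support from `F`. -/
theorem exists_mulClass_eq [Nontrivial R] (hK : HasSphericalLinks K R n)
    (hω : IsFundamentalClass K R n ω) {k : ℕ} (hk : k ≠ 0) {F : FlagFunctions V R k (n + 1)}
    (hF : F ∈ flagChains K R k (n + 1)) (hd : simplexDiff K R k n F = 0) :
    ∃ f ∈ compactCochains K R k, mulClass ω k f = F := by
  have key : ∀ x, ∃ r : R, (¬ IsOrderedSimplex K x → r = 0) ∧ F x = r • starClass ω x := by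
    intro x
    by_cases hx : IsOrderedSimplex K x
    · obtain ⟨r, hr⟩ := exists_eq_smul_starClass hK hω hx (flagChains_mem_starChains hF x)
        (congrFun hd x)
      exact ⟨r, fun h => absurd hx h, hr⟩
    · refine ⟨0, fun _ => rfl, ?_⟩
      rw [zero_smul]
      by_contra h
      exact hx (isOrderedSimplex_of_flagChains_ne_zero hk hF h)
  choose f hf hfF using key
  refine ⟨f, ⟨⟨hf, fun x π => ?_⟩, hF.2.2.2.subset fun x hx h => hx ?_⟩,
    funext fun x => (hfF x).symm⟩
  · by_cases hx : IsOrderedSimplex K x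
    · have h1 := hF.2.2.1 x π
      rw [hfF, hfF, starClass_congr hK.locallyFinite hω.mem_cochains hk
        (π.surjective.range_comp x), ← smul_assoc, ← sub_eq_zero, ← sub_smul] at h1
      exact sub_eq_zero.1 (eq_zero_of_smul_starClass_eq_zero hK hω hx h1)
    · rw [hf x hx, smul_zero, hf]
      intro h
      have := h.comp π⁻¹
      rw [Function.comp_assoc] at this
      exact hx (by simpa using this)
  · by_cases hx' : IsOrderedSimplex K x
    · rw [hfF] at h
      exact eq_zero_of_smul_starClass_eq_zero hK hω hx' h
    · exact hf x hx'

theorem coboundaries_eq_zero {k : ℕ} {f : (Fin k → V) → R} (hf : f ∈ coboundaries K R k)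
    {x : Fin k → V} (hx : ¬ IsOrderedSimplex K x) : f x = 0 := by
  cases k with
  | zero =>
    have : f = 0 := hf
    rw [this]
    rfl
  | succ k =>
    obtain ⟨g, -, rfl⟩ := hf
    exact if_neg hx

/-- The end of the staircase, and the only place where the twist enters: translating `f` alone
differs from translating `f` times `ω` by the factor `χ γ`. -/
theorem corresponds_cocycles [Nontrivial R] (hK : HasSphericalLinks K R n)
    (hω : IsFundamentalClass K R n ω) {χ : Γᵐᵒᵖ → R} (hχ : ∀ γ, χ γ * χ γ = 1)
    (hωχ : ∀ (γ : Γᵐᵒᵖ) x, ω (γ.unop • x) = χ γ * ω x) {k : ℕ} (hk : k ≠ 0) :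
    Corresponds χ (functionRep R Γ k) (cocycles K R k) (coboundaries K R k)
      (flagRep V R Γ k (n + 1)) (flagCycles K R k n)
      ((coboundaries K R k).map (mulClass ω k)) := by
  classical
  refine Corresponds.of_linearMap (mulClass ω k) (cocycles_le_comap _) ?_ ?_ ?_ ?_
  · rintro f ⟨hf, hf'⟩
    have hf' : coboundary K R k f = 0 := hf'
    refine ⟨⟨mulClass_mem hK hω hk hf, ?_⟩, simplexDiff_mulClass hK hω hk f⟩
    rw [SetLike.mem_coe, LinearMap.mem_ker, faceDiff_mulClass hK hω hk hf, hf', map_zero]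
  · rintro F ⟨⟨hF, hF1⟩, hF2⟩
    obtain ⟨f, hf, rfl⟩ := exists_mulClass_eq hK hω hk hF hF2
    refine ⟨f, ⟨hf, ?_⟩, rfl⟩
    rw [SetLike.mem_coe, LinearMap.mem_ker, faceDiff_mulClass hK hω hk hf] at hF1
    exact mulClass_injective hK hω (fun x hx => if_neg hx) (fun _ _ => rfl)
      (hF1.trans (map_zero _).symm)
  · rintro f ⟨hf, -⟩
    refine ⟨fun h => ⟨f, h, rfl⟩, ?_⟩
    rintro ⟨g, hg, hgf⟩
    rwa [← mulClass_injective hK hω (fun x hx => coboundaries_eq_zero hg hx) hf.1.1 hgf]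
  · intro γ f _
    ext x y
    have h1 : ∀ r s t : R, r * t = s * (r * (s * t)) ↔ r * t = s * s * (r * t) := fun r s t => by
      rw [show s * (r * (s * t)) = s * s * (r * t) by ring]
    rw [Pi.smul_apply, Finsupp.smul_apply, flagRep_apply_apply, mulClass_apply, mulClass_apply,
      Finsupp.smul_apply, Finsupp.smul_apply, starClass_apply hK.locallyFinite hω.mem_cochains hk,
      starClass_apply hK.locallyFinite hω.mem_cochains hk]
    by_cases h : Set.range x ⊆ Set.range y
    · rw [if_pos h, if_pos ((range_smul_subset_iff _).2 h), hωχ]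
      change f (γ.unop • x) * ω y = χ γ * (f (γ.unop • x) * (χ γ * ω y))
      rw [h1, hχ, one_mul]
    · rw [if_neg h, if_neg fun h' => h ((range_smul_subset_iff _).1 h')]
      simp

/-! ### Assembling the staircase -/

theorem compactCochains_zero_eq_bot : compactCochains K R 0 = ⊥ := by
  rw [eq_bot_iff]
  intro f hf
  exact funext fun x => hf.1.1 x (not_isOrderedSimplex_zero x)

theorem map_coboundaries_eq_faceBoundaries [Nontrivial R] (hK : HasSphericalLinks K R n)
    (hω : IsFundamentalClass K R n ω) {k : ℕ} (hk : k ≠ 0) :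
    (coboundaries K R (k + 1)).map (mulClass ω (k + 1)) = faceBoundaries K R k n := by
  refine le_antisymm ?_ ?_
  · rintro _ ⟨_, ⟨f, hf, rfl⟩, rfl⟩
    exact ⟨mulClass ω k f, ⟨mulClass_mem hK hω hk hf, simplexDiff_mulClass hK hω hk f⟩,
      faceDiff_mulClass hK hω hk hf⟩
  · rintro _ ⟨F, ⟨hF, hF'⟩, rfl⟩
    obtain ⟨f, hf, rfl⟩ := exists_mulClass_eq hK hω hk hF hF'
    exact ⟨_, ⟨f, hf, rfl⟩, (faceDiff_mulClass hK hω hk hf).symm⟩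

theorem flagChains_eq_bot [Nontrivial R] (hK : HasSphericalLinks K R n) (a : ℕ) {b : ℕ}
    (hb : n + 1 < b) : flagChains K R a b = ⊥ := by
  rw [eq_bot_iff]
  intro F hF
  ext1 x
  have := hF.1 x
  rw [hK.chains_eq_bot hb] at this
  exact this

theorem corresponds_cycles_coboundaries [Nontrivial R] (hK : HasSphericalLinks K R n)
    (hω : IsFundamentalClass K R n ω) {b k : ℕ} (h : b + k = n) :
    Corresponds (fun _ => 1) (finsuppRep R Γ (b + 1)) (cycles K R (b + 1)) (boundaries K R (b + 1))
      (flagRep V R Γ (k + 1) (n + 1)) (flagCycles K R (k + 1) n)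
      ((coboundaries K R (k + 1)).map (mulClass ω (k + 1))) := by
  -- For `k = 0` the staircase has no stair, and the boundaries on both sides vanish: there are
  -- neither cochains with no vertices nor chains on `n + 2` vertices.
  cases k with
  | zero =>
    obtain rfl : b = n := h
    have h1 : (coboundaries K R (0 + 1)).map (mulClass ω (0 + 1)) = simplexBoundaries K R 1 b := by
      rw [coboundaries, compactCochains_zero_eq_bot, simplexBoundaries,
        flagChains_eq_bot hK 1 (by omega), bot_inf_eq, Submodule.map_bot, Submodule.map_bot,
        Submodule.map_bot]
    rw [h1]
    exact corresponds_cycles b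
  | succ k =>
    obtain rfl : n = k + b + 1 := by omega
    rw [map_coboundaries_eq_faceBoundaries hK hω (by omega)]
    have h1 := (corresponds_cycles_flagCycles (Γ := Γ) hK k b (by omega)).trans
      (corresponds_step (Γ := Γ) hK (a := k + 1) (b := k + b) (by omega) (by omega))
    simpa only [mul_one] using h1

theorem corresponds_of_eq_bot {G M N : Type*} [Monoid G] [AddCommGroup M] [Module R M]
    [AddCommGroup N] [Module R N] {χ : G → R} {ρ : Representation R G M} {Z B : Submodule R M}
    {σ : Representation R G N} {Z' B' : Submodule R N} (h : Z = ⊥) (h' : Z' = ⊥) :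
    Corresponds χ ρ Z B σ Z' B' := by
  subst h h'
  refine Corresponds.of_linearMap 0 (fun g z hz => ?_) (fun z _ => zero_mem _) ?_ ?_ ?_
  · rw [Submodule.mem_bot] at hz
    rw [hz]
    exact zero_mem _
  · rintro z' hz'
    exact ⟨0, zero_mem _, ((Submodule.mem_bot R).1 hz').symm⟩
  · rintro z hz
    rw [Submodule.mem_bot] at hz
    rw [hz]
    exact ⟨fun _ => zero_mem _, fun _ => zero_mem _⟩
  · intro g z _
    simp

/-- Cocycles with compact supports correspond to cycles of complementary degree. -/
theorem corresponds_cocycles_cycles [Nontrivial R] (hK : HasSphericalLinks K R n)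
    (hω : IsFundamentalClass K R n ω) {χ : Γᵐᵒᵖ → R} (hχ : ∀ γ, χ γ * χ γ = 1)
    (hωχ : ∀ (γ : Γᵐᵒᵖ) x, ω (γ.unop • x) = χ γ * ω x) (i : ℤ) :
    Corresponds χ (functionRep R Γ (i + 1).toNat) (cocycles K R (i + 1).toNat)
      (coboundaries K R (i + 1).toNat) (finsuppRep R Γ ((n : ℤ) - i + 1).toNat)
      (cycles K R ((n : ℤ) - i + 1).toNat) (boundaries K R ((n : ℤ) - i + 1).toNat) := by
  have hcoc : ∀ p, p = 0 ∨ n + 1 < p → cocycles K R p = ⊥ := by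
    intro p hp
    rw [eq_bot_iff]
    rintro f ⟨hf, -⟩
    refine funext fun x => hf.1.1 x fun hx => ?_
    have h1 := hK.card_le hx
    have h2 := hx.ne_zero
    omega
  have hcyc : ∀ q, q = 0 ∨ n + 1 < q → cycles K R q = ⊥ := by
    intro q hq
    rw [eq_bot_iff]
    intro c hc
    have hc' : c ∈ chains K R q := by
      cases q with
      | zero => exact hc
      | succ q => exact hc.1
    rcases hq with rfl | hq
    · rwa [chains_zero_eq_bot] at hc'
    · rwa [hK.chains_eq_bot hq] at hc'
  -- Outside this range one of the two vertex counts is `0` and the other exceeds `n + 1`, so both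
  -- sides vanish.
  by_cases hi : 0 ≤ i ∧ i ≤ n
  · obtain ⟨k, hk⟩ : ∃ k : ℕ, (i + 1).toNat = k + 1 := ⟨i.toNat, by omega⟩
    obtain ⟨b, hb⟩ : ∃ b : ℕ, ((n : ℤ) - i + 1).toNat = b + 1 := ⟨((n : ℤ) - i).toNat, by omega⟩
    rw [hk, hb]
    have h1 := (corresponds_cocycles hK hω hχ hωχ k.succ_ne_zero).trans
      ((corresponds_cycles_coboundaries (Γ := Γ) hK hω (b := b) (k := k) (by omega)).symm
        fun _ => one_mul 1)
    simpa only [mul_one] using h1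
  · exact corresponds_of_eq_bot (hcoc _ (by omega)) (hcyc _ (by omega))

end Action

end HomologyManifold

end

theorem theorem5 {R : Type*} [CommRing R] {V : Type*} {Γ : Type*} [Group Γ] [MulAction Γ V]
    (n : ℕ) (L : AbstractSimplicialComplex V)
    (hL : HomologyManifold.IsHomologyManifold R n L)
    (hconn : (HomologyManifold.oneSkeleton L).Connected)
    [HomologyManifold.IsSimplicialAction L.toPreAbstractSimplicialComplex Γ]
    (hfree : HomologyManifold.IsFreeAction L.toPreAbstractSimplicialComplex Γ)
    (hor : Nonempty (HomologyManifold.Orientation L.toPreAbstractSimplicialComplex n) ∨ CharP R 2)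
    (i : ℤ) :
    Nonempty (Representation.Equiv
      ((HomologyManifold.compactCohomologyRep L.toPreAbstractSimplicialComplex R Γ i).tprod
        (HomologyManifold.orientationModule L.toPreAbstractSimplicialComplex R Γ n))
      (HomologyManifold.homologyRep L.toPreAbstractSimplicialComplex R Γ ((n : ℤ) - i))) := by
  rcases subsingleton_or_nontrivial R with hR | hR
  · have h1 := Module.subsingleton R
      (HomologyManifold.CompactCohomology L.toPreAbstractSimplicialComplex R i ⊗[R] R)
    have h2 := Module.subsingleton R
      (HomologyManifold.Homology L.toPreAbstractSimplicialComplex R ((n : ℤ) - i))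
    exact ⟨Representation.Equiv.mk 0 fun g => LinearMap.ext fun x => Subsingleton.elim _ _⟩
  · have hK := hL.hasSphericalLinks
    obtain ⟨ω, hω, hωχ⟩ := HomologyManifold.exists_isFundamentalClass (Γ := Γ) hK hconn hor
    have hχ := HomologyManifold.orientationSign_mul_self (R := R) (n := n) (Γ := Γ)
      (K := L.toPreAbstractSimplicialComplex)
    obtain ⟨e, he⟩ :=
      (HomologyManifold.corresponds_cocycles_cycles hK hω hχ hωχ i).exists_linearEquiv
      (HomologyManifold.cocycles_le_comap _) (HomologyManifold.coboundaries_le_comap _)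
      (HomologyManifold.cycles_le_comap _) (HomologyManifold.boundaries_le_comap _)
    -- The isomorphism `e` is equivariant up to the orientation sign; the sign by which `g` acts on
    -- the second tensor factor cancels it, since the sign squares to one.
    refine ⟨Representation.Equiv.mk ((TensorProduct.rid R _).trans e) fun g => ?_⟩
    refine TensorProduct.ext' fun x r => ?_
    have h1 : HomologyManifold.orientationModule L.toPreAbstractSimplicialComplex R Γ n g r =
        HomologyManifold.orientationSign L.toPreAbstractSimplicialComplex R n g * r := by
      simp [HomologyManifold.orientationModule, HomologyManifold.orientationSign]
    have h2 := he g x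
    simp only [LinearMap.comp_apply, LinearEquiv.coe_coe, LinearEquiv.trans_apply,
      Representation.tprod_apply, TensorProduct.map_tmul, TensorProduct.rid_tmul, map_smul, h1]
    change _ • e (HomologyManifold.subquotientRep _ _ _ _ _ g x) = _
    rw [h2, smul_smul, mul_right_comm, hχ, one_mul]
    rfl
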